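/- Let $\mathbb{Z}+i\mathbb{Z}$ be the set of Gaussian integers. A \emph{complete curve} associated to a sequence $(a_k)_{k\in\mathbb{Z}}$ with $a_k\in\{+1,-1\}$ is a sequence $(C_k)_{k\in\mathbb{Z}}$ of oriented segments $C_k=[x_k,x_k+\varepsilon_k]$ with $x_k\in\mathbb{Z}+i\mathbb{Z}$, $\varepsilon_k\in\{1,-1,i,-i\}$, $x_{k+1}=x_k+\varepsilon_k$ and $\varepsilon_{k+1}=i^{a_k}\varepsilon_k$ for all $k$; two sequences which differ only in the numbering of the segments are the same curve. A \emph{covering} is a set of complete curves such that each nonoriented interval $[z,z+\varepsilon]$ with $z\in\mathbb{Z}+i\mathbb{Z}$ and $\varepsilon\in\{1,i\}$ is the support of exactly one segment of exactly one curve of the set. The empty sequence is the only $0$-folding sequence, and the $(n+1)$-folding sequences are the sequences $(-s_m,\ldots,-s_1,e,s_1,\ldots,s_m)$ with $(s_1,\ldots,s_m)$ an $n$-folding sequence and $e\in\{+1,-1\}$. A complete curve is a \emph{complete folding curve} if each finite block $(a_{k+1},\ldots,a_{k+l})$ of its sequence is a block of consecutive terms of some $n$-folding sequence. A \emph{pattern}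 of a covering $\mathcal{C}$ is a finite set of oriented segments of curves of $\mathcal{C}$, together with the relation "$t$ follows $s$ on a curve of $\mathcal{C}$" between its elements. A \emph{copy} of it in a covering $\mathcal{D}$ is its image under a translation by a Gaussian integer $u$ such that the images of its segments are oriented segments of curves of $\mathcal{D}$ and, for all $s,t$ in the pattern, $t+u$ follows $s+u$ on a curve of $\mathcal{D}$ if and only if $t$ follows $s$ on a curve of $\mathcal{C}$. The covering $\mathcal{C}$ satisfies the \emph{local isomorphism property} if, for each pattern of $\mathcal{C}$, there is a real number $r$ such that each disc of radius $r$ in $\mathbb{C}$ contains a copy of that pattern in $\mathcal{C}$. Two coverings are \emph{locally isomorphic} if each pattern of either of them has a copy in the other. \textbf{Proposition.} Let $\mathcal{C}$ be a covering by complete folding curves which satisfies the local isomorphism property. Then there exists a covering $\mathcal{D}$ which is locally isomorphic to $\mathcal{C}$ and consists of exactly $2$ curves, both of which are complete folding curves. -/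

import Mathlib

namespace Paperfolding

/-- The imaginary unit in the ring `ℤ + iℤ` of Gaussian integers. -/
def I : GaussianInt := ⟨0, 1⟩

/-- An oriented unit segment `[x, x + ε]` of the lattice `ℤ + iℤ`, with `ε ∈ {1, -1, i, -i}`. -/
@[ext]
structure Segment where
  /-- the initial point `x` -/
  source : GaussianInt
  /-- the direction `ε` -/
  dir : GaussianInt
  dir_mem : dir = 1 ∨ dir = -1 ∨ dir = I ∨ dir = -I

namespace Segment

/-- The terminal point `x + ε` of a segment. -/
def target (s : Segment) : GaussianInt := s.source + s.dir

/-- The nonoriented interval which supports a segment, given by its pair of endpoints. -/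
def support (s : Segment) : Sym2 GaussianInt := s(s.source, s.target)

/-- The image of an oriented segment under the translation `v ↦ v + u`. -/
def translate (u : GaussianInt) (s : Segment) : Segment := ⟨s.source + u, s.dir, s.dir_mem⟩

/-- The segment is contained in the open disc of `ℂ` with center `z` and radius `r`
(a disc is convex, so that it is enough to look at the endpoints). -/
def InBall (z : ℂ) (r : ℝ) (s : Segment) : Prop :=
  GaussianInt.toComplex s.source ∈ Metric.ball z r ∧
    GaussianInt.toComplex s.target ∈ Metric.ball z r

end Segment

/-- A complete curve `(C_k)_{k ∈ ℤ}` associated to the sequence `(a_k)_{k ∈ ℤ}` of signs: `C_{k+1}`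
starts where `C_k` ends, and `ε_{k+1} = i ^ a_k * ε_k` (for a sign `a`, one has `i ^ a = a * i`).
The rounding of the curve at its vertices is not a further datum: as consecutive segments are
perpendicular, rounded curves avoid each other, and themselves, exactly when no two of their
segments have the same support. -/
@[ext]
structure CompleteCurve where
  /-- the segment `C_k` -/
  seg : ℤ → Segment
  /-- the sign `a_k`, which describes the turn from `C_k` to `C_{k+1}` -/
  turn : ℤ → ℤˣ
  source_succ : ∀ k, (seg (k + 1)).source = (seg k).target
  dir_succ : ∀ k, (seg (k + 1)).dir = (((turn k : ℤˣ) : ℤ) : GaussianInt) * I * (seg k).dir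

/-- `n`-folding sequences: the sequences of turns of a strip of paper folded `n` times in two, each
time to the left or to the right, and then unfolded. The first fold makes the turn `e` in the
middle; the `n` further folds make a sequence `S` on one half, and `S` reversed with opposite signs
on the other half. -/
inductive IsFoldingSequence : ℕ → List ℤˣ → Prop
  | zero : IsFoldingSequence 0 []
  | succ {n : ℕ} {S : List ℤˣ} (e : ℤˣ) (h : IsFoldingSequence n S) :
      IsFoldingSequence (n + 1) ((S.map (fun a => -a)).reverse ++ e :: S)

/-- Complete folding sequences: each `(a_{k+1}, …, a_{k+l})` is a block of consecutive terms of an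
`n`-folding sequence for some `n`. -/
def IsCompleteFoldingSequence (a : ℤ → ℤˣ) : Prop :=
  ∀ (k : ℤ) (l : ℕ), ∃ (n : ℕ) (S : List ℤˣ), IsFoldingSequence n S ∧
    (List.ofFn fun j : Fin l => a (k + 1 + (j : ℤ))) <:+: S

/-- A complete folding curve is a complete curve associated to a complete folding sequence. -/
def CompleteCurve.IsFolding (C : CompleteCurve) : Prop := IsCompleteFoldingSequence C.turn

/-- A covering (of the plane): a set of complete curves such that each nonoriented interval
`[z, z + ε]` with `z ∈ ℤ + iℤ` and `ε ∈ {1, i}` is the support of exactly one segment of exactly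
one curve of the set. (In particular, the set cannot contain two curves which
differ only in the numbering of their segments.) -/
def IsCovering (𝒞 : Set CompleteCurve) : Prop :=
  ∀ z ε : GaussianInt, (ε = 1 ∨ ε = I) →
    ∃! p : CompleteCurve × ℤ, p.1 ∈ 𝒞 ∧ (p.1.seg p.2).support = s(z, z + ε)

/-- `s` is one of the segments of the curves of `𝒞`. -/
def IsSegmentOf (𝒞 : Set CompleteCurve) (s : Segment) : Prop :=
  ∃ C ∈ 𝒞, ∃ k, C.seg k = s

/-- `s` and `t` are consecutive segments, in this order, of a curve of `𝒞`. -/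
def Consecutive (𝒞 : Set CompleteCurve) (s t : Segment) : Prop :=
  ∃ C ∈ 𝒞, ∃ k, C.seg k = s ∧ C.seg (k + 1) = t

/-- A bounded set of curves contained in `𝒞` is given by the finite set `F` of its segments,
two of them being consecutive when they are so in `𝒞`. It is embedded in `𝒟` by the translation
of vector `u` if its segments are sent to segments of `𝒟`, and any two of them are consecutive
if and only if their images are consecutive in `𝒟`. -/
def IsEmbedding (𝒞 𝒟 : Set CompleteCurve) (F : Finset Segment) (u : GaussianInt) : Prop :=
  (∀ s ∈ F, IsSegmentOf 𝒟 (s.translate u)) ∧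
    ∀ s ∈ F, ∀ t ∈ F, Consecutive 𝒞 s t ↔ Consecutive 𝒟 (s.translate u) (t.translate u)

/-- The local isomorphism property: for each bounded set of curves contained in `𝒞` there
is a radius `r` such that each disc of radius `r` contains a translated copy of it in `𝒞`. -/
def LocalIsomorphismProperty (𝒞 : Set CompleteCurve) : Prop :=
  ∀ F : Finset Segment, (∀ s ∈ F, IsSegmentOf 𝒞 s) →
    ∃ r : ℝ, ∀ z : ℂ, ∃ u : GaussianInt,
      IsEmbedding 𝒞 𝒞 F u ∧ ∀ s ∈ F, (s.translate u).InBall z r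

/-- Each bounded set of curves contained in `𝒞` has a translated copy in `𝒟`. -/
def LocallyEmbeds (𝒞 𝒟 : Set CompleteCurve) : Prop :=
  ∀ F : Finset Segment, (∀ s ∈ F, IsSegmentOf 𝒞 s) →
    ∃ u : GaussianInt, IsEmbedding 𝒞 𝒟 F u

/-- `𝒞` and `𝒟` are locally isomorphic if they contain the same bounded sets of curves up to
translation. -/
def LocallyIsomorphic (𝒞 𝒟 : Set CompleteCurve) : Prop :=
  LocallyEmbeds 𝒞 𝒟 ∧ LocallyEmbeds 𝒟 𝒞

end Paperfolding

/-! Unfolding a folding curve produces a hierarchy. A segment of direction `(1 + i) i ^ d` folds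
into two segments of directions `i ^ d` and `i ^ (d + 1)`; the only freedom is which comes first,
that is, whether the first half is horizontal or vertical. So `n`-fold curves are the words `word o
n d`, where the bit `o k` records this choice at level `k`. Compactness attaches to a complete
folding curve one sequence `o` which accounts for all its blocks
(`IsCompleteFoldingSequence.exists_parities`).

In the plane, a second sequence of bits `t` tells, at each level, which coset of the multiples of `1
+ i` carries the vertices of the next lattice. Given `o` and `t`, each nonoriented edge gets one
orientation, and each oriented edge is a half of exactly one edge of the next level (`parent`).
Edges whose ancestors `anc o t n g` eventually coincide lie on one curve. While `o` is imposed, `t`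
is free, and the number of classes of edges depends on it.

Division by `1 + i` contracts, so the ancestors of any edge eventually enter a finite set, `core`. A
finite game on `core`, won against every continuation of `o`, shows that `t` can be continued so as
to merge `core` into one edge (`merges_core`), or into two distinct edges in one of finitely many
positions from which the game can be restarted (`separates_core`). Playing the second game forever
gives exactly two classes (`exists_anc_eq_or_eq`). No vertex then lies in all the lattices, since
its edges would represent at least three classes; so each class is a single biinfinite folding
curve, and the two curves form the covering `𝒟`.

Local isomorphism comes from the first game and one curve `C` of `𝒞`. A pattern of `𝒟` lies in two
edges of some level `n`; changing `t` above level `n` puts both in one edge, whose word occurs in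
`C`. Conversely, all the edges of a disc can be put in one edge, so a block of `C` fills a disc of
any given radius. By the local isomorphism property each pattern of `𝒞` has a copy in such a disc,
hence in a block of `C`, and this block occurs in the curves of `𝒟`. -/

namespace Paperfolding

/-! ### Words of directions

The direction `I ^ d` is encoded by `d : ZMod 4`. -/

/-- Parity of a direction: `false` for horizontal, `true` for vertical. -/
def odd (d : ZMod 4) : Bool := decide (d = 1 ∨ d = 3)

/-- First direction of the two halves of a folded segment of direction `(1 + i) i ^ d`,
when the first half has parity `o`. -/
def fst (o : Bool) (d : ZMod 4) : ZMod 4 := if odd d = o then d else d + 1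

/-- Second direction of the two halves of a folded segment. -/
def snd (o : Bool) (d : ZMod 4) : ZMod 4 := if odd d = o then d + 1 else d

/-- Directions of the curve obtained by folding `n` times a segment. -/
def word (o : ℕ → Bool) : ℕ → ZMod 4 → List (ZMod 4)
  | 0, d => [d]
  | n + 1, d => word o n (fst (o n) d) ++ word o n (snd (o n) d)

/-- The turn between two consecutive directions. -/
def turnOf (a b : ZMod 4) : ℤˣ := if b = a + 1 then 1 else -1

/-- The sequence of turns of a sequence of directions. -/
def turns : List (ZMod 4) → List ℤˣ
  | a :: b :: l => turnOf a b :: turns (b :: l)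
  | _ => []

/-- Two perpendicular directions. -/
def Perp (a b : ZMod 4) : Prop := b = a + 1 ∨ b = a + 3

instance : DecidableRel Perp := fun _ _ => inferInstanceAs (Decidable (_ ∨ _))

theorem turns_append (l₁ l₂ : List (ZMod 4)) (a b : ZMod 4) :
    turns (l₁ ++ a :: b :: l₂) = turns (l₁ ++ [a]) ++ turnOf a b :: turns (b :: l₂) := by
  induction l₁ with
  | nil => simp [turns]
  | cons x l ih =>
    cases l with
    | nil => simp [turns]
    | cons y l => simpa [turns] using ih

theorem turns_map_add (c : ZMod 4) (l : List (ZMod 4)) : turns (l.map (· + c)) = turns l := by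
  induction l with
  | nil => rfl
  | cons x l ih =>
    cases l with
    | nil => rfl
    | cons y l =>
      have : turnOf (x + c) (y + c) = turnOf x y := by
        simp only [turnOf]
        congr 1
        rw [add_right_comm x c 1, add_left_inj]
      simp only [List.map_cons] at ih
      simp only [turns, List.map_cons, this, ih]

theorem turnOf_swap {a b : ZMod 4} (h : Perp a b) : turnOf b a = -turnOf a b := by
  revert a b; decide

theorem turns_reverse {l : List (ZMod 4)} (h : l.IsChain Perp) :
    turns l.reverse = ((turns l).map (fun a => -a)).reverse := by
  induction l with
  | nil => rfl
  | cons x l ih =>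
    cases l with
    | nil => rfl
    | cons y l =>
      rw [List.isChain_cons_cons] at h
      have := ih h.2
      simp only [List.reverse_cons] at this
      simp only [List.reverse_cons, List.append_assoc, List.cons_append, List.nil_append,
        turns_append, this, turns, List.map_cons, turnOf_swap h.1]

theorem turns_infix {l₁ l₂ : List (ZMod 4)} (h : l₁ <:+: l₂) : turns l₁ <:+: turns l₂ := by
  obtain ⟨s, t, rfl⟩ := h
  have key : ∀ (s l : List (ZMod 4)), turns l <:+ turns (s ++ l) := by
    intro s l
    induction s with
    | nil => exact List.suffix_refl _
    | cons x s ih =>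
      cases hs : s ++ l with
      | nil =>
        have : l = [] := by simp_all
        subst this; simp [turns]
      | cons y r =>
        rw [List.cons_append, hs, turns, ← hs]
        exact ih.trans (List.suffix_cons _ _)
  have key2 : ∀ (l t : List (ZMod 4)), turns l <+: turns (l ++ t) := by
    intro l t
    induction l with
    | nil => simp [turns]
    | cons x l ih =>
      cases l with
      | nil => simp [turns]
      | cons y l =>
        simp only [List.cons_append, turns] at ih ⊢
        exact (List.prefix_cons_inj _).2 ih
  exact ((key2 l₁ t).isInfix.trans (key s (l₁ ++ t)).isInfix).trans (by rw [List.append_assoc])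

theorem word_length (o : ℕ → Bool) (n : ℕ) (d : ZMod 4) : (word o n d).length = 2 ^ n := by
  induction n generalizing d with
  | zero => rfl
  | succ n ih => simp [word, ih, pow_succ, mul_two]

theorem word_ne_nil (o : ℕ → Bool) (n : ℕ) (d : ZMod 4) : word o n d ≠ [] := by
  rw [← List.length_pos_iff, word_length]; positivity

theorem word_congr {o o' : ℕ → Bool} {n : ℕ} (h : ∀ i < n, o i = o' i) (d : ZMod 4) :
    word o n d = word o' n d := by
  induction n generalizing d with
  | zero => rfl
  | succ n ih =>
    simp only [word, h n (Nat.lt_succ_self n), ih (fun i hi => h i (hi.trans (Nat.lt_succ_self n)))]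

/-- A quarter turn exchanges the roles of the first and second halves at every level, hence the
reversal. Applied to the two halves of a fold, this is the antisymmetry in the definition of folding
sequences. -/
theorem word_add_one (o : ℕ → Bool) (n : ℕ) (d : ZMod 4) :
    word o n (d + 1) = (word o n d).reverse.map (· + 1) := by
  induction n generalizing d with
  | zero => rfl
  | succ n ih =>
    have h1 : ∀ (b : Bool) (d : ZMod 4), fst b (d + 1) = snd b d + 1 := by decide
    have h2 : ∀ (b : Bool) (d : ZMod 4), snd b (d + 1) = fst b d + 1 := by decide
    simp [word, h1, h2, ih]

theorem word_split (o : ℕ → Bool) (n : ℕ) (d : ZMod 4) :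
    ∃ (x : ZMod 4) (l l' : List (ZMod 4)), word o n d = l ++ [x] ∧
      word o n (d + 1) = (x + 1) :: l' := by
  obtain ⟨l, x, h⟩ := List.eq_nil_or_concat' (word o n d) |>.resolve_left (word_ne_nil o n d)
  exact ⟨x, l, l.reverse.map (· + 1), h, by simp [word_add_one, h]⟩

theorem word_split' (o : ℕ → Bool) (n : ℕ) (d : ZMod 4) :
    ∃ (x : ZMod 4) (l l' : List (ZMod 4)), word o n (d + 1) = l ++ [x + 1] ∧
      word o n d = x :: l' := by
  obtain ⟨x, l, h⟩ := List.exists_cons_of_ne_nil (word_ne_nil o n d)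
  exact ⟨x, l.reverse.map (· + 1), l, by simp [word_add_one, h], h⟩

theorem word_isChain (o : ℕ → Bool) (n : ℕ) (d : ZMod 4) : (word o n d).IsChain Perp := by
  induction n generalizing d with
  | zero => simp [word]
  | succ n ih =>
    rw [word, List.isChain_append]
    refine ⟨ih _, ih _, ?_⟩
    unfold fst snd
    split
    · obtain ⟨x, l, l', h, h'⟩ := word_split o n d
      simp [h, h', Perp]
    · obtain ⟨x, l, l', h, h'⟩ := word_split' o n d
      have key : ∀ x : ZMod 4, Perp (x + 1) x := by decide
      simp [h, h', key]

theorem turns_word_add_one (o : ℕ → Bool) (n : ℕ) (d : ZMod 4) :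
    turns (word o n (d + 1)) = ((turns (word o n d)).map (fun a => -a)).reverse := by
  rw [word_add_one, turns_map_add, turns_reverse (word_isChain o n d)]

theorem turns_word_succ (o : ℕ → Bool) (n : ℕ) (d : ZMod 4) :
    turns (word o (n + 1) d) = ((turns (word o n (snd (o n) d))).map (fun a => -a)).reverse ++
      (if odd d = o n then 1 else -1) :: turns (word o n (snd (o n) d)) := by
  rw [word, fst, snd]
  split
  · obtain ⟨x, l, l', h, h'⟩ := word_split o n d
    have e := turns_word_add_one o n d
    have e' : ((turns (word o n (d + 1))).map (fun a => -a)).reverse = turns (word o n d) := by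
      rw [e]; simp
    rw [e', h, h', List.append_assoc, List.singleton_append, turns_append]
    simp [turnOf]
  · rw [← turns_word_add_one]
    obtain ⟨x, l, l', h, h'⟩ := word_split' o n d
    rw [h, h', List.append_assoc, List.singleton_append, turns_append]
    have key : ∀ x : ZMod 4, turnOf (x + 1) x = -1 := by decide
    rw [key]

theorem isFoldingSequence_turns_word (o : ℕ → Bool) (n : ℕ) (d : ZMod 4) :
    IsFoldingSequence n (turns (word o n d)) := by
  induction n generalizing d with
  | zero => exact .zero
  | succ n ih =>
    rw [turns_word_succ]
    exact .succ _ (ih _)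

theorem IsFoldingSequence.exists_word {n : ℕ} {S : List ℤˣ} (h : IsFoldingSequence n S) :
    ∃ o d, turns (word o n d) = S := by
  induction h with
  | zero => exact ⟨fun _ => false, 0, rfl⟩
  | @succ n S e h ih =>
    obtain ⟨o, d, rfl⟩ := ih
    obtain ⟨b, d', hs, he⟩ : ∃ b d', snd b d' = d ∧ (if odd d' = b then 1 else -1) = e := by
      clear h
      revert d e; decide
    refine ⟨Function.update o n b, d', ?_⟩
    have : ∀ d, word (Function.update o n b) n d = word o n d := fun d =>
      word_congr (fun i hi => Function.update_of_ne hi.ne _ _) d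
    rw [turns_word_succ, Function.update_self, this, hs, he]

/-- Odd rotations exchange horizontal and vertical, so they flip every bit of `o`; even ones change
none. -/
theorem word_rotate (o : ℕ → Bool) (n : ℕ) (d c : ZMod 4) :
    word (fun i => xor (o i) (odd c)) n (d + c) = (word o n d).map (· + c) := by
  induction n generalizing d with
  | zero => rfl
  | succ n ih =>
    have h1 : ∀ (b : Bool) (d c : ZMod 4), fst (xor b (odd c)) (d + c) = fst b d + c := by decide
    have h2 : ∀ (b : Bool) (d c : ZMod 4), snd (xor b (odd c)) (d + c) = snd b d + c := by decide
    simp [word, h1, h2, ih]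

/-- The first `n` bits act as a substitution on the word made with the later bits. This is the
source of all the recurrence statements. -/
theorem word_add (o : ℕ → Bool) (n k : ℕ) (d : ZMod 4) :
    word o (n + k) d = (word (fun i => o (n + i)) k d).flatMap (word o n) := by
  induction k generalizing d with
  | zero => simp [word]
  | succ k ih => simp [word, ih]

/-! ### Walks -/

/-- The element of `ZMod 4` associated to a turn. -/
def angle (e : ℤˣ) : ZMod 4 := if e = 1 then 1 else 3

/-- The directions of the walk with initial direction `d` and given turns. -/
def walk : ZMod 4 → List ℤˣ → List (ZMod 4)
  | d, [] => [d]
  | d, e :: S => d :: walk (d + angle e) S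

theorem walk_eq_cons (d : ZMod 4) (S : List ℤˣ) : ∃ l, walk d S = d :: l := by
  cases S <;> simp [walk]

theorem turns_walk (d : ZMod 4) (S : List ℤˣ) : turns (walk d S) = S := by
  induction S generalizing d with
  | nil => rfl
  | cons e S ih =>
    obtain ⟨l, hl⟩ := walk_eq_cons (d + angle e) S
    have : turnOf d (d + angle e) = e := by clear hl ih; revert d e; decide
    rw [walk, hl, turns, ← hl, ih, this]

theorem walk_turns {d : ZMod 4} {l : List (ZMod 4)} (h : (d :: l).IsChain Perp) :
    walk d (turns (d :: l)) = d :: l := by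
  induction l generalizing d with
  | nil => rfl
  | cons x l ih =>
    rw [List.isChain_cons_cons] at h
    have : d + angle (turnOf d x) = x := by
      have := h.1; clear h ih; revert d x; decide
    rw [turns, walk, this, ih h.2]

theorem walk_rotate (d c : ZMod 4) (S : List ℤˣ) : walk (d + c) S = (walk d S).map (· + c) := by
  induction S generalizing d with
  | nil => rfl
  | cons e S ih => simp [walk, ← ih, add_right_comm]

theorem walk_infix {S T : List ℤˣ} (h : S <:+: T) (d : ZMod 4) : ∃ d', walk d S <:+: walk d' T := by
  obtain ⟨s, t, rfl⟩ := h
  rw [List.append_assoc]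
  have h1 : walk d S <+: walk d (S ++ t) := by
    induction S generalizing d with
    | nil => obtain ⟨l, hl⟩ := walk_eq_cons d t; simp [walk, hl]
    | cons e S ih => simpa [walk] using ih _
  induction s with
  | nil => exact ⟨d, h1.isInfix⟩
  | cons e s ih =>
    obtain ⟨d', hd⟩ := ih
    refine ⟨d' - angle e, hd.trans ?_⟩
    simp only [List.cons_append, walk, sub_add_cancel]
    exact (List.suffix_cons _ _).isInfix

theorem IsFoldingSequence.walk_infix_word {n : ℕ} {S T : List ℤˣ} (h : IsFoldingSequence n S)
    (hT : T <:+: S) (d : ZMod 4) : ∃ o d', walk d T <:+: word o n d' := by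
  obtain ⟨d', hd⟩ := walk_infix hT d
  obtain ⟨o, c, rfl⟩ := h.exists_word
  obtain ⟨x, l, hx⟩ := List.exists_cons_of_ne_nil (word_ne_nil o n c)
  have h1 : walk x (turns (word o n c)) = word o n c := by
    rw [hx]; exact walk_turns (hx ▸ word_isChain o n c)
  -- The word realizing `S` starts with some direction `x`; it is rotated so as to start with `d'`.
  refine ⟨_, _, hd.trans (?_ : _ <:+: word (fun i => xor (o i) (odd (d' - x))) n (c + (d' - x)))⟩
  rw [word_rotate]
  nth_rw 2 [← h1]
  rw [← walk_rotate, add_sub_cancel]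

/-! ### Recurrence -/

/-- A finite check on the five bits involved. With `word_add` it shows that any two perpendicular
consecutive blocks reappear five levels higher, whatever the bits. -/
theorem pair_infix_word (o : ℕ → Bool) (d a b : ZMod 4) (h : Perp a b) :
    [a, b] <:+: word o 5 d := by
  have key : ∀ b0 b1 b2 b3 b4 : Bool, ∀ d a b : ZMod 4, Perp a b →
      [a, b] <:+: word (fun i => [b0, b1, b2, b3, b4].getD i false) 5 d := by
    decide +kernel
  have e : word o 5 d = word (fun i => [o 0, o 1, o 2, o 3, o 4].getD i false) 5 d := by
    apply word_congr
    intro i hi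
    interval_cases i <;> rfl
  rw [e]
  exact key _ _ _ _ _ _ _ _ h

theorem word_append_infix_word (o : ℕ → Bool) (n : ℕ) (d a b : ZMod 4) (h : Perp a b) :
    word o n a ++ word o n b <:+: word o (n + 5) d := by
  obtain ⟨s, t, e⟩ := pair_infix_word (fun i => o (n + i)) d a b h
  rw [word_add, ← e]
  exact ⟨s.flatMap (word o n), t.flatMap (word o n), by simp⟩

theorem word_infix_word (o : ℕ → Bool) (n : ℕ) (d a : ZMod 4) :
    word o n a <:+: word o (n + 5) d :=
  List.infix_append_left.trans (word_append_infix_word o n d a (a + 1) (Or.inl rfl))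

/-- A factor no longer than one block meets at most two consecutive blocks. -/
theorem infix_two_blocks {f : ZMod 4 → List (ZMod 4)} {L : ℕ} (hf : ∀ x, (f x).length = L)
    {v W : List (ZMod 4)} (hv : v.IsChain Perp) (hW : W <:+: v.flatMap f) (hL : W.length ≤ L) :
    ∃ a b, Perp a b ∧ W <:+: f a ++ f b := by
  induction v with
  | nil => exact ⟨0, 1, Or.inl rfl, by simp_all⟩
  | cons x v ih =>
    rw [List.flatMap_cons, List.infix_append_iff] at hW
    rcases hW with h | h | ⟨s, p, rfl, hs, hp⟩
    · exact ⟨x, x + 1, Or.inl rfl, h.trans List.infix_append_left⟩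
    · exact ih (List.IsChain.tail hv) h
    · cases v with
      | nil =>
        have : p = [] := by simpa using hp
        subst this
        refine ⟨x, x + 1, Or.inl rfl, ?_⟩
        rw [List.append_nil]
        exact hs.isInfix.trans List.infix_append_left
      | cons y v =>
        rw [List.isChain_cons_cons] at hv
        refine ⟨x, y, hv.1, ?_⟩
        have : p <+: f y := List.prefix_of_prefix_length_le (by simpa using hp)
          (List.prefix_append (f y) (v.flatMap f)) (by rw [hf]; simp at hL; omega)
        exact List.infix_append_iff.2 (Or.inr (Or.inr ⟨s, p, rfl, hs, this⟩))

theorem block_infix {f : ZMod 4 → List (ZMod 4)} {L : ℕ} (hf : ∀ x, (f x).length = L) (h0 : 0 < L)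
    {v W : List (ZMod 4)} (hW : W <:+: v.flatMap f) (hL : 2 * L ≤ W.length) :
    ∃ a, f a <:+: W := by
  induction v with
  | nil => simp_all
  | cons x v ih =>
    rw [List.flatMap_cons, List.infix_append_iff] at hW
    rcases hW with h | h | ⟨s, p, rfl, hs, hp⟩
    · have := h.length_le
      rw [hf] at this; omega
    · exact ih h
    · have := hs.length_le
      rw [hf] at this
      rw [List.length_append] at hL
      cases v with
      | nil =>
        have : p = [] := by simpa using hp
        subst this; simp at hL; omega
      | cons y v =>
        refine ⟨y, ?_⟩
        have : f y <+: p := List.prefix_of_prefix_length_le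
          (List.prefix_append (f y) (v.flatMap f)) (by simpa using hp) (by rw [hf]; omega)
        exact this.isInfix.trans List.infix_append_right

/-! ### Windows of a sequence of directions -/

/-- The list of the `l` terms of `f` from the `k`-th one. -/
def window (f : ℤ → ZMod 4) (k : ℤ) (l : ℕ) : List (ZMod 4) :=
  (List.range l).map fun j : ℕ => f (k + j)

@[simp] theorem window_length (f : ℤ → ZMod 4) (k : ℤ) (l : ℕ) : (window f k l).length = l := by
  simp [window]

theorem window_succ (f : ℤ → ZMod 4) (k : ℤ) (l : ℕ) :
    window f k (l + 1) = f k :: window f (k + 1) l := by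
  simp only [window, List.range_succ_eq_map, List.map_cons, List.map_map]
  congr 1
  · simp
  · apply List.map_congr_left
    intro j _
    simp [add_comm, add_left_comm]

theorem window_add (f : ℤ → ZMod 4) (k : ℤ) (l l' : ℕ) :
    window f k (l + l') = window f k l ++ window f (k + l) l' := by
  simp only [window, List.range_add, List.map_append, List.map_map]
  congr 1
  apply List.map_congr_left
  intro j _
  simp [add_assoc]

theorem window_infix (f : ℤ → ZMod 4) {k k' : ℤ} {l l' : ℕ} (h : k' ≤ k) (h' : k + l ≤ k' + l') :
    window f k l <:+: window f k' l' := by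
  obtain ⟨a, rfl⟩ := Int.le.dest h
  obtain ⟨b, rfl⟩ : ∃ b, l' = a + l + b := ⟨l' - (a + l), by omega⟩
  rw [window_add, window_add]
  exact ⟨_, _, rfl⟩

/-- The finite sequence `W` occurs in the sequence `f`. -/
def Occurs (f : ℤ → ZMod 4) (W : List (ZMod 4)) : Prop := ∃ k, window f k W.length = W

theorem Occurs.of_infix {f : ℤ → ZMod 4} {W W' : List (ZMod 4)} (h : Occurs f W')
    (hW : W <:+: W') : Occurs f W := by
  obtain ⟨k, hk⟩ := h
  obtain ⟨s, t, rfl⟩ := hW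
  refine ⟨k + s.length, ?_⟩
  rw [List.length_append, List.length_append, window_add, window_add] at hk
  have := List.append_inj' hk (by simp)
  exact (List.append_inj' this.1 (by simp)).2

theorem occurs_window (f : ℤ → ZMod 4) (k : ℤ) (l : ℕ) : Occurs f (window f k l) :=
  ⟨k, by rw [window_length]⟩

section Address

variable {a : ℤ → ℤˣ} {f : ℤ → ZMod 4} (hf : ∀ k, f (k + 1) = f k + angle (a k))

include hf

theorem window_eq_walk (k : ℤ) (l : ℕ) :
    window f k (l + 1) = walk (f k) (List.ofFn fun j : Fin l => a (k + (j : ℤ))) := by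
  induction l generalizing k with
  | zero => simp [window, walk]
  | succ l ih =>
    rw [window_succ, ih, List.ofFn_succ, walk]
    simp [hf, add_comm, add_left_comm]

theorem turns_window (k : ℤ) (l : ℕ) :
    turns (window f k (l + 1)) = List.ofFn fun j : Fin l => a (k + (j : ℤ)) := by
  rw [window_eq_walk hf, turns_walk]

theorem IsCompleteFoldingSequence.window_infix_word (ha : IsCompleteFoldingSequence a) (k : ℤ)
    (l : ℕ) : ∃ o n d, window f k l <:+: word o n d := by
  obtain ⟨n, S, hS, h⟩ := ha (k - 1) l
  rw [sub_add_cancel] at h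
  obtain ⟨o, d, ho⟩ := hS.walk_infix_word h (f k)
  rw [← window_eq_walk hf] at ho
  exact ⟨o, n, d, (window_infix f le_rfl (by push_cast; omega)).trans ho⟩

theorem isCompleteFoldingSequence_of_window
    (h : ∀ (k : ℤ) (l : ℕ), ∃ o n d, window f k l <:+: word o n d) :
    IsCompleteFoldingSequence a := by
  intro k l
  obtain ⟨o, n, d, h⟩ := h (k + 1) (l + 1)
  refine ⟨n, _, isFoldingSequence_turns_word o n d, ?_⟩
  rw [← turns_window hf]
  exact turns_infix h

/-- Each central window comes with its own bits. By compactness of `ℕ → Bool` a subsequence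
converges, so that arbitrarily large windows agree with the limit on any given number of bits. -/
theorem IsCompleteFoldingSequence.exists_limit (ha : IsCompleteFoldingSequence a) :
    ∃ o : ℕ → Bool, ∀ m : ℕ, ∀ N : ℕ, ∃ o' n d, (∀ i < m, o' i = o i) ∧
      window f (-N) (2 * N) <:+: word o' n d := by
  have h : ∀ N : ℕ, ∃ o n d, window f (-N) (2 * N) <:+: word o n d := fun N =>
    ha.window_infix_word hf _ _
  choose O n d h using h
  obtain ⟨o, φ, hφ, hlim⟩ := CompactSpace.tendsto_subseq O
  refine ⟨o, fun m N => ?_⟩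
  have h1 : ∀ i, ∀ᶠ j in Filter.atTop, O (φ j) i = o i := fun i => by
    have := (tendsto_pi_nhds.1 hlim) i
    rw [nhds_discrete, Filter.tendsto_pure] at this
    exact this
  have h2 : ∀ᶠ j in Filter.atTop, ∀ i ∈ Set.Iio m, O (φ j) i = o i :=
    (Filter.eventually_all_finite (Set.finite_Iio m)).2 fun i _ => h1 i
  obtain ⟨j, hj, hj'⟩ := (h2.and (Filter.eventually_ge_atTop N)).exists
  refine ⟨O (φ j), n (φ j), d (φ j), hj, (window_infix f ?_ ?_).trans (h (φ j))⟩
  all_goals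
    have := hφ.id_le j
    simp only [id] at this
    omega

/-- A complete folding sequence determines the parities of the first halves at each level. -/
theorem IsCompleteFoldingSequence.exists_parities (ha : IsCompleteFoldingSequence a) :
    ∃ o : ℕ → Bool, (∀ n d, Occurs f (word o n d)) ∧
      ∀ k l, ∃ n, ∀ d, window f k l <:+: word o n d := by
  obtain ⟨o, ho⟩ := ha.exists_limit hf
  -- A window longer than `2 ^ m` lies in a word of level greater than `m`, hence in a concatenation
  -- of level-`m` blocks, which only depend on the first `m` bits.
  have key : ∀ m N : ℕ, 2 ^ m < 2 * N → ∃ v : List (ZMod 4), v.IsChain Perp ∧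
      window f (-N) (2 * N) <:+: v.flatMap (word o m) := by
    intro m N hN
    obtain ⟨o', n, d, h1, h2⟩ := ho m N
    have h3 := h2.length_le
    rw [window_length, word_length] at h3
    have h4 : m < n := (Nat.pow_lt_pow_iff_right (by norm_num : 1 < 2)).1 (hN.trans_le h3)
    obtain ⟨k, rfl⟩ := Nat.exists_eq_add_of_lt h4
    rw [add_assoc, word_add] at h2
    have e : word o' m = word o m := funext fun d => word_congr h1 d
    rw [e] at h2
    exact ⟨_, word_isChain _ _ _, h2⟩
  refine ⟨o, fun n d => ?_, fun k l => ?_⟩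
  · obtain ⟨v, -, hv⟩ := key (n + 5) (2 ^ (n + 5)) (by have := Nat.two_pow_pos (n + 5); omega)
    obtain ⟨x, hx⟩ := block_infix (word_length o (n + 5)) (by positivity) hv (by simp)
    exact ((occurs_window f _ _).of_infix hx).of_infix (word_infix_word o n x d)
  · obtain ⟨m, hm⟩ : ∃ m, l ≤ 2 ^ m := ⟨l, Nat.lt_two_pow_self.le⟩
    obtain ⟨v, hc, hv⟩ := key m (2 ^ m + k.natAbs + l) (by have := Nat.two_pow_pos m; omega)
    have := (window_infix f (k := k) (l := l) (by omega) (by omega)).trans hv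
    obtain ⟨x, y, hxy, h⟩ := infix_two_blocks (word_length o m) hc this (by simpa using hm)
    exact ⟨m + 5, fun d => h.trans (word_append_infix_word o m d x y hxy)⟩

end Address

/-! ### Folding and unfolding of oriented edges -/

/-- An oriented edge of the lattice, given by its source and its direction. -/
abbrev Dart := GaussianInt × ZMod 4

/-- Real part of `i ^ d`. -/
def dx (d : ZMod 4) : ℤ := if d = 0 then 1 else if d = 2 then -1 else 0

/-- Imaginary part of `i ^ d`. -/
def dy (d : ZMod 4) : ℤ := if d = 1 then 1 else if d = 3 then -1 else 0

/-- The unit `i ^ d`. -/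
def dv (d : ZMod 4) : GaussianInt := ⟨dx d, dy d⟩

/-- Parity of a vertex. -/
def parity (z : GaussianInt) : Bool := decide ((z.re + z.im) % 2 = 1)

/-- The integer `0` or `1` associated to a bit. -/
def bit (t : Bool) : ℤ := if t then 1 else 0

/-- The vertex `(1 + i) y + t`. -/
def up (t : Bool) (y : GaussianInt) : GaussianInt := ⟨y.re - y.im + bit t, y.re + y.im⟩

/-- The vertex `(z - t) / (1 + i)`. -/
def half (t : Bool) (z : GaussianInt) : GaussianInt :=
  ⟨(z.re - bit t + z.im) / 2, (z.im - z.re + bit t) / 2⟩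

/-- Target of an oriented edge. -/
def tgt (g : Dart) : GaussianInt := g.1 + dv g.2

/-- First half of a folded edge. -/
def child₁ (o t : Bool) (g : Dart) : Dart := (up t g.1, fst o g.2)

/-- Second half of a folded edge. -/
def child₂ (o t : Bool) (g : Dart) : Dart := (up t g.1 + dv (fst o g.2), snd o g.2)

/-- The edges with the orientation determined by the parity of their source. -/
def Admissible (o t : Bool) (g : Dart) : Prop := odd g.2 = xor (parity g.1) (xor o t)

instance (o t : Bool) : DecidablePred (Admissible o t) := fun _ =>
  inferInstanceAs (Decidable (_ = _))

/-- The edge of which an admissible edge is a half. -/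
def parent (t o t' o' : Bool) (g : Dart) : Dart :=
  if odd g.2 = o then
    (half t g.1, if odd g.2 = xor (parity (half t g.1)) (xor o' t') then g.2 else g.2 + 3)
  else
    (half t (tgt g) -
      dv (if odd g.2 = !(xor (parity (half t (tgt g))) (xor o' t')) then g.2 else g.2 + 3),
      if odd g.2 = !(xor (parity (half t (tgt g))) (xor o' t')) then g.2 else g.2 + 3)

theorem dv_eq (d : ZMod 4) : (dx d = 1 ∧ dy d = 0) ∨ (dx d = -1 ∧ dy d = 0) ∨
    (dx d = 0 ∧ dy d = 1) ∨ (dx d = 0 ∧ dy d = -1) := by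
  revert d; decide

theorem dv_injective : Function.Injective dv := by
  intro a b h
  have h1 := congrArg Zsqrtd.re h
  have h2 := congrArg Zsqrtd.im h
  simp only [dv] at h1 h2
  revert a b; decide

theorem dv_ne_zero (d : ZMod 4) : dv d ≠ 0 := by
  revert d; decide

theorem parity_up (t : Bool) (y : GaussianInt) : parity (up t y) = t := by
  cases t <;> simp [parity, up, bit] <;> omega

theorem half_up (t : Bool) (y : GaussianInt) : half t (up t y) = y := by
  cases t <;> ext <;> simp [half, up, bit] <;> omega

theorem up_half {t : Bool} {z : GaussianInt} (h : parity z = t) : up t (half t z) = z := by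
  subst h
  by_cases h : (z.re + z.im) % 2 = 1 <;> ext <;> simp [half, up, bit, parity, h] <;> omega

theorem parity_add_dv (z : GaussianInt) (d : ZMod 4) : parity (z + dv d) = !parity z := by
  rcases dv_eq d with h | h | h | h <;> simp only [parity, dv, Zsqrtd.re_add, Zsqrtd.im_add, h] <;>
    rw [← decide_not] <;> congr 1 <;> simp only [eq_iff_iff] <;> omega

theorem parity_sub_dv (z : GaussianInt) (d : ZMod 4) : parity (z - dv d) = !parity z := by
  have := parity_add_dv (z - dv d) d
  rw [sub_add_cancel] at this
  rw [this, Bool.not_not]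

theorem up_add_dv (o t : Bool) (y : GaussianInt) (d : ZMod 4) :
    up t (y + dv d) = up t y + dv (fst o d) + dv (snd o d) := by
  have h : ∀ (o : Bool) (d : ZMod 4), dx d - dy d = dx (fst o d) + dx (snd o d) ∧
    dx d + dy d = dy (fst o d) + dy (snd o d) := by decide
  have := h o d
  ext <;> simp [up, dv] <;> omega

theorem tgt_child₁ (o t : Bool) (g : Dart) : tgt (child₁ o t g) = (child₂ o t g).1 := rfl

theorem tgt_child₂ (o t : Bool) (g : Dart) : tgt (child₂ o t g) = up t (tgt g) :=
  (up_add_dv o t _ _).symm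

theorem odd_fst (o : Bool) (d : ZMod 4) : odd (fst o d) = o := by revert o d; decide

theorem odd_snd (o : Bool) (d : ZMod 4) : odd (snd o d) = !o := by revert o d; decide

theorem admissible_child₁ (o t : Bool) (g : Dart) : Admissible o t (child₁ o t g) := by
  simp only [Admissible, child₁, odd_fst, parity_up]
  cases o <;> cases t <;> rfl

theorem admissible_child₂ (o t : Bool) (g : Dart) : Admissible o t (child₂ o t g) := by
  simp only [Admissible, child₂, odd_snd, parity_up, parity_add_dv]
  cases o <;> cases t <;> rfl

/-- The half has direction `d` or `d + 1`, so its parent has the same direction or the previous one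
(`+ 3`); admissibility of the parent prescribes the parity and decides. -/
theorem parent_child₁ {o t o' t' : Bool} {g : Dart} (h : Admissible o' t' g) :
    parent t o t' o' (child₁ o t g) = g := by
  have key : ∀ (o : Bool) (d : ZMod 4),
    (if odd (fst o d) = odd d then fst o d else fst o d + 3) = d := by decide
  rw [parent, if_pos (show odd (child₁ o t g).2 = o from odd_fst o g.2)]
  simp only [child₁, half_up]
  rw [← h, key]

theorem parent_child₂ {o t o' t' : Bool} {g : Dart} (h : Admissible o' t' g) :
    parent t o t' o' (child₂ o t g) = g := by
  have key : ∀ (o : Bool) (d : ZMod 4),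
    (if odd (snd o d) = odd d then snd o d else snd o d + 3) = d := by decide
  have e : (!(xor (parity (tgt g)) (xor o' t'))) = odd g.2 := by
    rw [tgt, parity_add_dv, h]
    cases parity g.1 <;> simp
  rw [parent, if_neg (by simp [child₂, odd_snd]), tgt_child₂, half_up, e]
  have k : (if odd (child₂ o t g).2 = odd g.2 then (child₂ o t g).2 else (child₂ o t g).2 + 3) = g.2 :=
    key o g.2
  rw [k, tgt, add_sub_cancel_right]

theorem Admissible.parity_eq_of_eq {o t : Bool} {g : Dart} (h : Admissible o t g)
    (h' : odd g.2 = o) : parity g.1 = t := by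
  rw [Admissible, h'] at h
  revert h; cases parity g.1 <;> cases o <;> cases t <;> simp

theorem Admissible.parity_eq_of_ne {o t : Bool} {g : Dart} (h : Admissible o t g)
    (h' : odd g.2 ≠ o) : parity (tgt g) = t := by
  rw [tgt, parity_add_dv]
  rw [Admissible] at h
  rw [h] at h'
  revert h'; cases parity g.1 <;> cases o <;> cases t <;> simp

theorem child₁_parent {o t : Bool} {g : Dart} (h : Admissible o t g) (h' : odd g.2 = o)
    (o' t' : Bool) : child₁ o t (parent t o t' o' g) = g := by
  have key : ∀ (o : Bool) (d : ZMod 4), odd d = o → fst o d = d ∧ fst o (d + 3) = d := by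
    decide
  rw [parent, if_pos h', child₁]
  ext1
  · exact up_half (h.parity_eq_of_eq h')
  · dsimp only
    split
    · exact (key o g.2 h').1
    · exact (key o g.2 h').2

theorem child₂_parent {o t : Bool} {g : Dart} (h : Admissible o t g) (h' : odd g.2 ≠ o)
    (o' t' : Bool) : child₂ o t (parent t o t' o' g) = g := by
  have key : ∀ (o : Bool) (d : ZMod 4), odd d ≠ o → snd o d = d ∧ snd o (d + 3) = d := by
    decide
  rw [parent, if_neg h', child₂]
  set d' := if odd g.2 = !(xor (parity (half t (tgt g))) (xor o' t')) then g.2 else g.2 + 3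
    with hd
  have h2 : snd o d' = g.2 := by
    rw [hd]
    split
    · exact (key o g.2 h').1
    · exact (key o g.2 h').2
  ext1
  · have := up_add_dv o t (half t (tgt g) - dv d') d'
    rw [sub_add_cancel, up_half (h.parity_eq_of_ne h'), h2, tgt] at this
    exact (add_right_cancel this).symm
  · exact h2

theorem admissible_parent (t o t' o' : Bool) (g : Dart) :
    Admissible o' t' (parent t o t' o' g) := by
  have key : ∀ (c : Bool) (d : ZMod 4), odd (if odd d = c then d else d + 3) = c := by decide
  unfold parent Admissible
  split
  · exact key _ _
  · simp only [key, parity_sub_dv]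
    simp

/-! ### Paths -/

/-- The edges of the path with initial vertex `x` and given directions. -/
def path : GaussianInt → List (ZMod 4) → List Dart
  | _, [] => []
  | x, d :: w => (x, d) :: path (x + dv d) w

theorem path_append (x : GaussianInt) (w w' : List (ZMod 4)) :
    path x (w ++ w') = path x w ++ path (x + (w.map dv).sum) w' := by
  induction w generalizing x with
  | nil => simp [path]
  | cons d w ih => simp [path, ih, add_assoc]

@[simp] theorem path_length (x : GaussianInt) (w : List (ZMod 4)) : (path x w).length = w.length := by
  induction w generalizing x with
  | nil => rfl
  | cons d w ih => simp [path, ih]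

theorem path_map_snd (x : GaussianInt) (w : List (ZMod 4)) : (path x w).map Prod.snd = w := by
  induction w generalizing x with
  | nil => rfl
  | cons d w ih => simp [path, ih]

theorem path_translate (x u : GaussianInt) (w : List (ZMod 4)) :
    path (x + u) w = (path x w).map fun g => (g.1 + u, g.2) := by
  induction w generalizing x with
  | nil => rfl
  | cons d w ih => simp [path, ← ih, add_right_comm]

theorem path_isChain (x : GaussianInt) {w : List (ZMod 4)} (hw : w.IsChain Perp) :
    (path x w).IsChain fun g h => h.1 = tgt g ∧ Perp g.2 h.2 := by
  induction w generalizing x with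
  | nil => simp [path]
  | cons d w ih =>
    cases w with
    | nil => simp [path]
    | cons d' w =>
      rw [List.isChain_cons_cons] at hw
      have := ih (x + dv d) hw.2
      simp only [path, List.isChain_cons_cons] at this ⊢
      exact ⟨⟨rfl, hw.1⟩, this⟩

/-! ### The hierarchy of edges -/

/-- Position in the initial lattice of a vertex of the `n`-th lattice. -/
def emb (t : ℕ → Bool) : ℕ → GaussianInt → GaussianInt
  | 0, y => y
  | n + 1, y => emb t n (up (t n) y)

/-- The path obtained by folding `n` times an edge. -/
def expand (o t : ℕ → Bool) (n : ℕ) (g : Dart) : List Dart := path (emb t n g.1) (word o n g.2)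

/-- Folding keeps the endpoints of an edge, so the expansions of consecutive edges fit together. -/
theorem emb_tgt (o t : ℕ → Bool) (n : ℕ) (g : Dart) :
    emb t n (tgt g) = emb t n g.1 + ((word o n g.2).map dv).sum := by
  induction n generalizing g with
  | zero => simp [emb, word, tgt]
  | succ n ih =>
    rw [emb, emb, word, ← tgt_child₂ (o n), ih, ← tgt_child₁, ih]
    simp [child₁, child₂, add_assoc]

theorem expand_succ (o t : ℕ → Bool) (n : ℕ) (g : Dart) :
    expand o t (n + 1) g =
      expand o t n (child₁ (o n) (t n) g) ++ expand o t n (child₂ (o n) (t n) g) := by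
  simp only [expand, word, path_append]
  congr 2
  rw [← tgt_child₁, emb_tgt o]
  rfl

theorem expand_length (o t : ℕ → Bool) (n : ℕ) (g : Dart) : (expand o t n g).length = 2 ^ n := by
  simp [expand, word_length]

/-- The edge of level `n` which contains a given edge of level `0`. -/
def anc (o t : ℕ → Bool) : ℕ → Dart → Dart
  | 0, g => g
  | n + 1, g => parent (t n) (o n) (t (n + 1)) (o (n + 1)) (anc o t n g)

/-- The position of an edge of level `0` in the edge of level `n` which contains it. -/
def pos (o t : ℕ → Bool) : ℕ → Dart → ℕ
  | 0, _ => 0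
  | n + 1, g => pos o t n g + if odd (anc o t n g).2 = o n then 0 else 2 ^ n

theorem admissible_anc {o t : ℕ → Bool} {g : Dart} (h : Admissible (o 0) (t 0) g) (n : ℕ) :
    Admissible (o n) (t n) (anc o t n g) := by
  cases n with
  | zero => exact h
  | succ n => exact admissible_parent _ _ _ _ _

theorem pos_lt (o t : ℕ → Bool) (n : ℕ) (g : Dart) : pos o t n g < 2 ^ n := by
  induction n with
  | zero => simp [pos]
  | succ n ih => rw [pos, pow_succ]; split <;> omega

theorem expand_anc_pos {o t : ℕ → Bool} {g : Dart} (h : Admissible (o 0) (t 0) g) (n : ℕ) :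
    (expand o t n (anc o t n g))[pos o t n g]? = some g := by
  induction n with
  | zero => simp [expand, anc, pos, path, word, emb]
  | succ n ih =>
    rw [expand_succ, pos, anc]
    split
    · next h' =>
      rw [child₁_parent (admissible_anc h n) h', List.getElem?_append_left, add_zero, ih]
      rw [expand_length]; exact pos_lt _ _ _ _
    · next h' =>
      rw [child₂_parent (admissible_anc h n) h', List.getElem?_append_right, expand_length,
        Nat.add_sub_cancel, ih]
      rw [expand_length]; exact Nat.le_add_left _ _

/-- Converse of `expand_anc_pos`: ancestor and position are coordinates which identify the
admissible edges of level `0` with the places in the expansions of the admissible edges of level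
`n`. -/
theorem anc_of_mem_expand {o t : ℕ → Bool} {n : ℕ} {g h : Dart} (hg : Admissible (o n) (t n) g)
    {j : ℕ} (hj : (expand o t n g)[j]? = some h) :
    Admissible (o 0) (t 0) h ∧ anc o t n h = g ∧ pos o t n h = j := by
  induction n generalizing g j with
  | zero =>
    cases j with
    | zero =>
      simp [expand, path, word, emb] at hj
      subst hj
      exact ⟨hg, rfl, rfl⟩
    | succ j => simp [expand, path, word, emb] at hj
  | succ n ih =>
    rw [expand_succ] at hj
    rcases lt_or_ge j (expand o t n (child₁ (o n) (t n) g)).length with hl | hl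
    · rw [List.getElem?_append_left hl] at hj
      obtain ⟨h1, h2, h3⟩ := ih (admissible_child₁ _ _ _) hj
      refine ⟨h1, by rw [anc, h2, parent_child₁ hg], ?_⟩
      rw [pos, h2, h3, if_pos (by simp [child₁, odd_fst]), add_zero]
    · rw [List.getElem?_append_right hl] at hj
      obtain ⟨h1, h2, h3⟩ := ih (admissible_child₂ _ _ _) hj
      refine ⟨h1, by rw [anc, h2, parent_child₂ hg], ?_⟩
      rw [expand_length] at h3 hl
      rw [pos, h2, h3, if_neg (by simp [child₂, odd_snd]), Nat.sub_add_cancel hl]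

/-- The sequence obtained by deleting the first `n` terms. -/
def shift (n : ℕ) (o : ℕ → Bool) : ℕ → Bool := fun i => o (n + i)

theorem anc_add (o t : ℕ → Bool) (n k : ℕ) (g : Dart) :
    anc o t (n + k) g = anc (shift n o) (shift n t) k (anc o t n g) := by
  induction k with
  | zero => rfl
  | succ k ih => rw [← add_assoc, anc, anc, ih]; rfl

/-- The index `n` is included because the orientation of the edges of level `n` depends on `t n`. -/
theorem anc_congr {o t t' : ℕ → Bool} {n : ℕ} (h : ∀ i ≤ n, t i = t' i) (g : Dart) :
    anc o t n g = anc o t' n g := by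
  induction n with
  | zero => rfl
  | succ n ih =>
    rw [anc, anc, ih fun i hi => h i (hi.trans n.le_succ), h n n.le_succ, h (n + 1) le_rfl]

theorem pos_congr {o t t' : ℕ → Bool} {n : ℕ} (h : ∀ i ≤ n, t i = t' i) (g : Dart) :
    pos o t n g = pos o t' n g := by
  induction n with
  | zero => rfl
  | succ n ih =>
    rw [pos, pos, ih fun i hi => h i (hi.trans n.le_succ),
      anc_congr fun i hi => h i (hi.trans n.le_succ)]

theorem anc_eq_of_le {o t : ℕ → Bool} {g h : Dart} {n m : ℕ} (hnm : n ≤ m)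
    (e : anc o t n g = anc o t n h) : anc o t m g = anc o t m h := by
  obtain ⟨k, rfl⟩ := Nat.exists_eq_add_of_le hnm
  rw [anc_add, anc_add, e]

/-- Above a common ancestor both positions receive the same increments. Hence the relative position
along a curve does not depend on the level. -/
theorem pos_sub_eq_of_le {o t : ℕ → Bool} {g h : Dart} {n m : ℕ} (hnm : n ≤ m)
    (e : anc o t n g = anc o t n h) :
    (pos o t m g : ℤ) - pos o t m h = pos o t n g - pos o t n h := by
  induction m, hnm using Nat.le_induction with
  | base => rfl
  | succ m hm ih =>
    rw [pos, pos, anc_eq_of_le hm e]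
    push_cast
    linarith

/-! ### Edges near the origin -/

/-- Condition on the position of the middle of an edge. -/
def Near (p q : ℤ) (g : Dart) : Prop :=
  (-p ≤ 2 * g.1.re + dx g.2 ∧ 2 * g.1.re + dx g.2 ≤ p) ∧
  (-p ≤ 2 * g.1.im + dy g.2 - 1 ∧ 2 * g.1.im + dy g.2 - 1 ≤ p) ∧
  (-q ≤ 2 * g.1.re + dx g.2 + (2 * g.1.im + dy g.2 - 1) ∧
    2 * g.1.re + dx g.2 + (2 * g.1.im + dy g.2 - 1) ≤ q) ∧
  (-q ≤ 2 * g.1.re + dx g.2 - (2 * g.1.im + dy g.2 - 1) ∧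
    2 * g.1.re + dx g.2 - (2 * g.1.im + dy g.2 - 1) ≤ q)

instance (p q : ℤ) : DecidablePred (Near p q) := fun _ => inferInstanceAs (Decidable (_ ∧ _ ∧ _))

/-- The admissible edges near the origin. -/
def core (o t : Bool) : List Dart :=
  ((List.range 5).flatMap fun i : ℕ => (List.range 6).flatMap fun j : ℕ =>
    [0, 1, 2, 3].map fun d => ((⟨(i : ℤ) - 2, (j : ℤ) - 2⟩, d) : Dart)).filter
      fun g => Admissible o t g ∧ Near 4 6 g

/-! ### The finite game on the core, in a form suited to evaluation by the kernel. -/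

/-- Numerical code of an edge, seen from its endpoint which belongs to the next lattice. -/
def code (o : Bool) (g : Dart) : ℕ :=
  let h : Dart := if odd g.2 = o then g else (tgt g, g.2 + 2)
  ((h.1.re + 16) * 128 + (h.1.im + 16) * 4).toNat + h.2.val

/-- Evaluation of the argument before the application of a function. -/
def force {α : Type} (n : ℕ) (k : ℕ → α) : α :=
  match n with
  | 0 => k 0
  | m + 1 => k (m + 1)

/-- The action of `parent` on the codes of edges. -/
def parentCode (t t' δ : Bool) (c : ℕ) : ℕ :=
  force ((c / 128 + c / 4 % 32 - t.toNat) / 2) fun x =>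
  force ((c / 4 % 32 + 32 + t.toNat - c / 128) / 2) fun y =>
  bif Nat.beq ((x + y) % 2) t'.toNat then x * 128 + y * 4 + (c + 4 - δ.toNat) % 4
  else force ((c + 3 + δ.toNat) % 4) fun e =>
    (x + (bif Nat.beq e 0 then 1 else 0) - (bif Nat.beq e 2 then 1 else 0)) * 128 +
    (y + (bif Nat.beq e 1 then 1 else 0) - (bif Nat.beq e 3 then 1 else 0)) * 4 + (e + 2) % 4

/-- Membership test for lists of numbers. -/
def memCode (c : ℕ) : List ℕ → Bool
  | [] => false
  | d :: S => Nat.beq c d || memCode c S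

/-- Application of a function to the set of the images of the elements of a list. -/
def withImage {α : Type} (f : ℕ → ℕ) : List ℕ → (List ℕ → α) → α
  | [], k => k []
  | c :: S, k => withImage f S fun r => force (f c) fun d => bif memCode d r then k r else k (d :: r)

/-- Comparison of the lengths of two lists. -/
def shorter : List ℕ → List ℕ → Bool
  | _, [] => false
  | [], _ :: _ => true
  | _ :: l, _ :: l' => shorter l l'

/-- A strategy for the choice of the vertices which makes all edges be merged. -/
def merges : ℕ → Bool → List ℕ → Bool
  | 0, _, S => shorter S [0, 0]
  | n + 1, t, S => shorter S [0, 0] || [false, true].all fun δ =>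
      withImage (parentCode t t δ) S fun S₀ => withImage (parentCode t (!t) δ) S fun S₁ =>
        bif shorter S₀ S₁ then merges n t S₀ else merges n (!t) S₁

/-- Pairs of edges at which the strategy below stops. -/
def goals : List (Bool × ℕ × ℕ) :=
  [(false, 1991, 2113), (false, 2112, 2246), (false, 1988, 2113), (false, 2113, 2114),
   (false, 2113, 2246), (false, 1988, 2123), (false, 2113, 2247), (true, 1995, 2117),
   (true, 1984, 2118), (true, 1985, 2119), (true, 2119, 2242), (true, 2109, 2242)]

/-- Membership in `goals`. -/
def isGoal (t : Bool) (p q : ℕ) : Bool :=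
  goals.any fun s => (s.1 == t) && (Nat.beq p s.2.1 && Nat.beq q s.2.2 ||
    Nat.beq q s.2.1 && Nat.beq p s.2.2)

/-- A strategy for the choice of the vertices which makes all edges be merged into
two distinct edges. -/
def separates : ℕ → Bool → ℕ → ℕ → List ℕ → Bool
  | 0, t, p, q, S => isGoal t p q && S.all fun c => Nat.beq c p || Nat.beq c q
  | n + 1, t, p, q, S => (isGoal t p q && S.all fun c => Nat.beq c p || Nat.beq c q) ||
      [false, true].all fun δ =>
      withImage (parentCode t t δ) S fun S₀ => withImage (parentCode t (!t) δ) S fun S₁ =>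
      force (parentCode t t δ p) fun p₀ => force (parentCode t t δ q) fun q₀ =>
      force (parentCode t (!t) δ p) fun p₁ => force (parentCode t (!t) δ q) fun q₁ =>
        bif (!Nat.beq p₀ q₀) && (Nat.beq p₁ q₁ || shorter S₀ S₁) then separates n t p₀ q₀ S₀
        else (!Nat.beq p₁ q₁) && separates n (!t) p₁ q₁ S₁

/-- The codes of the admissible edges near the origin. -/
def coreCodes (t : Bool) : List ℕ := (core false t).map (code false)

/-- At each level the opponent picks the bit `δ` and the greedy reply keeps whichever coset leaves
fewer edges; 14 levels always suffice. -/
theorem merges_core (t : Bool) : merges 14 t (coreCodes t) = true := by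
  revert t; decide +kernel

/-- From every position in `goals`, with the whole core in play, the two marked edges are kept
distinct until all edges have merged into them at a position of `goals` again. -/
theorem separates_core :
    goals.all (fun s => separates 14 s.1 s.2.1 s.2.2 (coreCodes s.1)) = true := by
  decide +kernel

theorem code_mem : ∀ (o t : Bool), ∀ g ∈ core o t, code o g ∈ coreCodes t := by
  decide +kernel

/-- Flipping `o` reverses all the edges and leaves the codes unchanged, so only `xor o o'` matters.
The shift by 16 in `code` keeps coordinates nonnegative, and the code is read in mixed radix as
(real part, imaginary part, direction). -/
theorem code_parent : ∀ (o t o' t' : Bool), ∀ g ∈ core o t,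
    code o' (parent t o t' o' g) = parentCode t t' (xor o o') (code o g) := by
  decide +kernel

theorem code_injOn : ∀ (o t : Bool), ∀ g ∈ core o t, ∀ h ∈ core o t, code o g = code o h → g = h := by
  decide +kernel

theorem exists_goal (o : Bool) : ∃ s ∈ goals, ∃ e ∈ core o s.1, ∃ f ∈ core o s.1,
    code o e = s.2.1 ∧ code o f = s.2.2 := by
  revert o; decide +kernel

theorem exists_third (o t : Bool) : ∀ g ∈ core o t, ∀ h ∈ core o t, ∃ e ∈ core o t, e ≠ g ∧ e ≠ h := by
  revert o t; decide +kernel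

theorem goals_ne : ∀ s ∈ goals, s.2.1 ≠ s.2.2 := by decide

/-! ### Contraction -/

theorem Near.mono {p q p' q' : ℤ} {g : Dart} (h : Near p q g) (hp : p ≤ p') (hq : q ≤ q') :
    Near p' q' g := by
  unfold Near at *; omega

/-- `Near` bounds twice the midpoint in an octagon, by `p` along the axes and by `q` along the
diagonals. Division by `1 + i` exchanges axes and diagonals. The center `i / 2` is the fixed point
of `z ↦ (z - 1/2) / (1 + i)`, the average of the two choices of coset. -/
theorem Near.of_child₁ {o t : Bool} {p q : ℤ} {g : Dart} (h : Near p q (child₁ o t g)) :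
    Near ((q + 2) / 2) (p + 2) g := by
  obtain ⟨⟨a, b⟩, d⟩ := g
  have key : ∀ (o : Bool) (d : ZMod 4), (dx d = dx (fst o d) ∧ dy d = dy (fst o d)) ∨
      (dx d = dy (fst o d) ∧ dy d = -dx (fst o d)) := by decide
  have k1 := key o d
  have k2 := dv_eq (fst o d)
  simp only [Near, child₁, up, bit] at h ⊢
  cases t <;> simp only [if_true, if_false, Bool.false_eq_true] at h <;> omega

theorem Near.of_child₂ {o t : Bool} {p q : ℤ} {g : Dart} (h : Near p q (child₂ o t g)) :
    Near ((q + 2) / 2) (p + 2) g := by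
  obtain ⟨⟨a, b⟩, d⟩ := g
  have key : ∀ (o : Bool) (d : ZMod 4),
      (dx d = dx (fst o d) ∧ dy d = dy (fst o d) ∧ dx (snd o d) = - dy d ∧ dy (snd o d) = dx d) ∨
      (dx d = dy (fst o d) ∧ dy d = -dx (fst o d) ∧ dx (snd o d) = dx d ∧
        dy (snd o d) = dy d) := by decide
  have k1 := key o d
  have k2 := dv_eq (fst o d)
  simp only [Near, child₂, up, bit, dv, Zsqrtd.re_add, Zsqrtd.im_add] at h ⊢
  cases t <;> simp only [if_true, if_false, Bool.false_eq_true] at h <;> omega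

theorem Near.parent {o t : Bool} {p q : ℤ} {g : Dart} (h : Near p q g) (hg : Admissible o t g)
    (t' o' : Bool) : Near ((q + 2) / 2) (p + 2) (parent t o t' o' g) := by
  by_cases h' : odd g.2 = o
  · rw [← child₁_parent hg h' o' t'] at h
    exact h.of_child₁
  · rw [← child₂_parent hg h' o' t'] at h
    exact h.of_child₂

theorem mem_core {o t : Bool} {g : Dart} : g ∈ core o t ↔ Admissible o t g ∧ Near 4 6 g := by
  rw [core, List.mem_filter, decide_eq_true_iff]
  refine and_iff_right_of_imp fun h => ?_
  obtain ⟨⟨a, b⟩, d⟩ := g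
  have h2 := h.2
  simp only [Near] at h2
  have := dv_eq d
  simp only [List.mem_flatMap, List.mem_range, List.mem_map]
  refine ⟨(a + 2).toNat, by omega, (b + 2).toNat, by omega, d, ?_, ?_⟩
  · clear h h2 this; revert d; decide
  · rw [Int.toNat_of_nonneg (by omega), Int.toNat_of_nonneg (by omega)]
    simp

theorem parent_mem_core {o t : Bool} {g : Dart} (h : g ∈ core o t) (t' o' : Bool) :
    parent t o t' o' g ∈ core o' t' := by
  rw [mem_core] at h ⊢
  -- The pair `(4, 6)` is a fixed point of `(p, q) ↦ ((q + 2) / 2, p + 2)`.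
  exact ⟨admissible_parent _ _ _ _ _, (h.2.parent h.1 t' o').mono (by norm_num) (by norm_num)⟩

theorem anc_mem_core {o t : ℕ → Bool} {g : Dart} (h : g ∈ core (o 0) (t 0)) (n : ℕ) :
    anc o t n g ∈ core (o n) (t n) := by
  induction n with
  | zero => exact h
  | succ n ih => exact parent_mem_core ih _ _

theorem anc_mem_core_of_le {o t : ℕ → Bool} {g : Dart} {n m : ℕ} (hnm : n ≤ m)
    (h : anc o t n g ∈ core (o n) (t n)) : anc o t m g ∈ core (o m) (t m) := by
  obtain ⟨k, rfl⟩ := Nat.exists_eq_add_of_le hnm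
  rw [anc_add]
  exact anc_mem_core (o := shift n o) (t := shift n t) h k

theorem exists_anc_mem_core (o t : ℕ → Bool) {g : Dart} (h : Admissible (o 0) (t 0) g) :
    ∃ n, anc o t n g ∈ core (o n) (t n) := by
  have key : ∀ (m : ℕ) (o t : ℕ → Bool) (g : Dart), Admissible (o 0) (t 0) g →
      Near (4 + m) (6 + m) g → ∃ n, anc o t n g ∈ core (o n) (t n) := by
    intro m
    induction m using Nat.strong_induction_on with
    | _ m ih =>
      intro o t g hg hn
      rcases Nat.eq_zero_or_pos m with rfl | hm
      · exact ⟨0, mem_core.2 ⟨hg, by simpa [anc] using hn⟩⟩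
      -- Two levels multiply lengths by `1/2`: the excess `m` over `(4, 6)` becomes `m / 2`.
      · have h1 := (hn.parent hg (t 1) (o 1)).parent (admissible_parent _ _ _ _ _) (t 2) (o 2)
        obtain ⟨n, hn⟩ := ih (m / 2) (by omega) (shift 2 o) (shift 2 t) (anc o t 2 g)
          (admissible_anc hg 2) (h1.mono (by push_cast; omega) (by push_cast; omega))
        exact ⟨2 + n, by rw [anc_add]; exact hn⟩
  refine key (4 * (g.1.re.natAbs + g.1.im.natAbs + 2)) o t g h ?_
  have h1 := dv_eq g.2
  have h2 : ((4 * (g.1.re.natAbs + g.1.im.natAbs + 2) : ℕ) : ℤ) =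
    4 * (|g.1.re| + |g.1.im| + 2) := by push_cast; rfl
  rw [h2]
  have h3 := neg_abs_le g.1.re
  have h4 := le_abs_self g.1.re
  have h5 := neg_abs_le g.1.im
  have h6 := le_abs_self g.1.im
  unfold Near
  omega

/-! ### Soundness of the strategies -/

theorem force_eq {α : Type} (n : ℕ) (k : ℕ → α) : force n k = k n := by
  cases n <;> rfl

theorem memCode_eq (c : ℕ) (S : List ℕ) : memCode c S = decide (c ∈ S) := by
  induction S with
  | nil => rfl
  | cons d S ih =>
    have : Nat.beq c d = decide (c = d) := by
      rw [Bool.eq_iff_iff, Nat.beq_eq, decide_eq_true_iff]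
    simp [memCode, ih, this]

theorem withImage_spec {α : Type} (f : ℕ → ℕ) (S : List ℕ) (k : List ℕ → α) :
    ∃ r : List ℕ, withImage f S k = k r ∧ ∀ c ∈ S, f c ∈ r := by
  induction S generalizing k with
  | nil => exact ⟨[], rfl, by simp⟩
  | cons c S ih =>
    obtain ⟨r, hr, hm⟩ := ih fun r => force (f c) fun d => bif memCode d r then k r else k (d :: r)
    simp only [force_eq, memCode_eq] at hr
    rw [withImage]
    simp only [force_eq, memCode_eq]
    rw [hr]
    by_cases hc : f c ∈ r
    · exact ⟨r, by simp [hc], by simpa [hc] using hm⟩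
    · exact ⟨f c :: r, by simp [hc], by simpa using fun c hc => Or.inr (hm c hc)⟩

/-- The sequence with given first term and given other terms. -/
def consSeq (b : Bool) (t : ℕ → Bool) : ℕ → Bool
  | 0 => b
  | n + 1 => t n

theorem anc_consSeq (o t : ℕ → Bool) (b : Bool) (n : ℕ) (g : Dart) :
    anc o (consSeq b t) (n + 1) g = anc (shift 1 o) t n (parent b (o 0) (t 0) (o 1) g) := by
  rw [add_comm, anc_add]
  congr 1
  funext i
  simp [shift, add_comm 1 i, consSeq]

/-- The game is won against all `δ`, so it can be played against the actual values `xor (o i) (o (i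
+ 1))`; `τ` records the replies. -/
theorem merges_sound {n : ℕ} {t : Bool} {S : List ℕ} (h : merges n t S = true) (o : ℕ → Bool) :
    ∃ (k : ℕ) (τ : ℕ → Bool), τ 0 = t ∧ ∀ g ∈ core (o 0) t, ∀ g' ∈ core (o 0) t,
      code (o 0) g ∈ S → code (o 0) g' ∈ S → anc o τ k g = anc o τ k g' := by
  have base : ∀ (t : Bool) (S : List ℕ) (o : ℕ → Bool), shorter S [0, 0] = true →
      ∃ (k : ℕ) (τ : ℕ → Bool), τ 0 = t ∧ ∀ g ∈ core (o 0) t, ∀ g' ∈ core (o 0) t,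
      code (o 0) g ∈ S → code (o 0) g' ∈ S → anc o τ k g = anc o τ k g' := by
    intro t S o h
    refine ⟨0, fun _ => t, rfl, fun g hg g' hg' hS hS' => code_injOn _ _ g hg g' hg' ?_⟩
    match S, h with
    | [], _ => simp at hS
    | [c], _ => simp_all
    | _ :: _ :: _, h => simp [shorter] at h
  induction n generalizing t S o with
  | zero => exact base t S o h
  | succ n ih =>
    rw [merges, Bool.or_eq_true] at h
    rcases h with h | h
    · exact base t S o h
    · have step : ∀ (t' : Bool) (S' : List ℕ), merges n t' S' = true →
          (∀ c ∈ S, parentCode t t' (xor (o 0) (o 1)) c ∈ S') →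
          ∃ (k : ℕ) (τ : ℕ → Bool), τ 0 = t ∧ ∀ g ∈ core (o 0) t, ∀ g' ∈ core (o 0) t,
          code (o 0) g ∈ S → code (o 0) g' ∈ S → anc o τ k g = anc o τ k g' := by
        intro t' S' hm hS'
        obtain ⟨k, τ, hτ, hk⟩ := ih hm (shift 1 o)
        refine ⟨k + 1, consSeq t τ, rfl, fun g hg g' hg' hgS hgS' => ?_⟩
        rw [anc_consSeq, anc_consSeq, hτ]
        have hc : ∀ g ∈ core (o 0) t, code (o 0) g ∈ S →
            code (shift 1 o 0) (parent t (o 0) t' (o 1) g) ∈ S' := by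
          intro g hg hgS
          have := code_parent (o 0) t (o 1) t' g hg
          exact this ▸ hS' _ hgS
        exact hk _ (parent_mem_core hg _ _) _ (parent_mem_core hg' _ _) (hc g hg hgS)
          (hc g' hg' hgS')
      have h' := List.all_eq_true.1 h (xor (o 0) (o 1)) (by cases xor (o 0) (o 1) <;> simp)
      obtain ⟨S₀, e₀, h₀⟩ := withImage_spec (parentCode t t (xor (o 0) (o 1))) S
        fun S₀ => withImage (parentCode t (!t) (xor (o 0) (o 1))) S fun S₁ =>
        bif shorter S₀ S₁ then merges n t S₀ else merges n (!t) S₁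
      rw [e₀] at h'
      obtain ⟨S₁, e₁, h₁⟩ := withImage_spec (parentCode t (!t) (xor (o 0) (o 1))) S
        fun S₁ => bif shorter S₀ S₁ then merges n t S₀ else merges n (!t) S₁
      rw [e₁] at h'
      cases hs : shorter S₀ S₁ with
      | true => rw [hs] at h'; exact step _ _ h' h₀
      | false => rw [hs] at h'; exact step _ _ h' h₁

theorem isGoal_iff {t : Bool} {p q : ℕ} :
    isGoal t p q = true ↔ (t, p, q) ∈ goals ∨ (t, q, p) ∈ goals := by
  rw [isGoal, List.any_eq_true]
  constructor
  · rintro ⟨⟨t', p', q'⟩, hs, h⟩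
    simp only [Bool.and_eq_true, Bool.or_eq_true, beq_iff_eq, Nat.beq_eq] at h
    obtain ⟨rfl, ⟨rfl, rfl⟩ | ⟨rfl, rfl⟩⟩ := h
    · exact Or.inl hs
    · exact Or.inr hs
  · rintro (h | h)
    · exact ⟨_, h, by simp [Nat.beq_refl]⟩
    · exact ⟨_, h, by simp [Nat.beq_refl]⟩

/-- Edges at which the strategy stops. -/
def Goal (o t : Bool) (e f : Dart) : Prop :=
  e ∈ core o t ∧ f ∈ core o t ∧ isGoal t (code o e) (code o f) = true

theorem separates_sound {n : ℕ} {t : Bool} {S : List ℕ} {p q : ℕ}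
    (h : separates n t p q S = true) (o : ℕ → Bool) {e f : Dart} (he : e ∈ core (o 0) t)
    (hf : f ∈ core (o 0) t) (hp : code (o 0) e = p) (hq : code (o 0) f = q) (hef : e ≠ f) :
    ∃ (k : ℕ) (τ : ℕ → Bool), τ 0 = t ∧ Goal (o k) (τ k) (anc o τ k e) (anc o τ k f) ∧
      (∀ i ≤ k, anc o τ i e ≠ anc o τ i f) ∧
      ∀ g ∈ core (o 0) t, code (o 0) g ∈ S →
        anc o τ k g = anc o τ k e ∨ anc o τ k g = anc o τ k f := by
  have base : ∀ (t : Bool) (S : List ℕ) (p q : ℕ) (o : ℕ → Bool) (e f : Dart),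
      e ∈ core (o 0) t → f ∈ core (o 0) t → code (o 0) e = p → code (o 0) f = q → e ≠ f →
      (isGoal t p q && S.all fun c => Nat.beq c p || Nat.beq c q) = true →
      ∃ (k : ℕ) (τ : ℕ → Bool), τ 0 = t ∧ Goal (o k) (τ k) (anc o τ k e) (anc o τ k f) ∧
      (∀ i ≤ k, anc o τ i e ≠ anc o τ i f) ∧
      ∀ g ∈ core (o 0) t, code (o 0) g ∈ S →
        anc o τ k g = anc o τ k e ∨ anc o τ k g = anc o τ k f := by
    rintro t S p q o e f he hf rfl rfl hef h
    rw [Bool.and_eq_true, List.all_eq_true] at h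
    refine ⟨0, fun _ => t, rfl, ⟨he, hf, h.1⟩, ?_, fun g hg hS => ?_⟩
    · intro i hi
      obtain rfl : i = 0 := by omega
      exact hef
    · have := h.2 _ hS
      simp only [Bool.or_eq_true, Nat.beq_eq] at this
      exact this.imp (code_injOn _ _ g hg e he) (code_injOn _ _ g hg f hf)
  induction n generalizing t S o p q e f with
  | zero => exact base t S p q o e f he hf hp hq hef h
  | succ n ih =>
    rw [separates, Bool.or_eq_true] at h
    rcases h with h | h
    · exact base t S p q o e f he hf hp hq hef h
    · have step : ∀ (t' : Bool) (S' : List ℕ),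
          separates n t' (parentCode t t' (xor (o 0) (o 1)) p)
            (parentCode t t' (xor (o 0) (o 1)) q) S' = true →
          parentCode t t' (xor (o 0) (o 1)) p ≠ parentCode t t' (xor (o 0) (o 1)) q →
          (∀ c ∈ S, parentCode t t' (xor (o 0) (o 1)) c ∈ S') →
          ∃ (k : ℕ) (τ : ℕ → Bool), τ 0 = t ∧ Goal (o k) (τ k) (anc o τ k e) (anc o τ k f) ∧
          (∀ i ≤ k, anc o τ i e ≠ anc o τ i f) ∧
          ∀ g ∈ core (o 0) t, code (o 0) g ∈ S →
            anc o τ k g = anc o τ k e ∨ anc o τ k g = anc o τ k f := by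
        intro t' S' hm hne hS'
        have hc : ∀ g ∈ core (o 0) t, code (shift 1 o 0) (parent t (o 0) t' (o 1) g) =
            parentCode t t' (xor (o 0) (o 1)) (code (o 0) g) :=
          fun g hg => code_parent (o 0) t (o 1) t' g hg
        obtain ⟨k, τ, hτ, hgoal, hk, hg⟩ := ih hm (shift 1 o) (parent_mem_core he _ _)
          (parent_mem_core hf _ _) ((hc e he).trans (by rw [hp])) ((hc f hf).trans (by rw [hq]))
          (fun hh => hne (by
            rw [← hp, ← hq]
            exact (hc e he).symm.trans ((congrArg (code (shift 1 o 0)) hh).trans (hc f hf))))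
        refine ⟨k + 1, consSeq t τ, rfl, ?_, ?_, fun g hgc hgS => ?_⟩
        · rw [anc_consSeq, anc_consSeq, hτ, consSeq, add_comm]
          exact hgoal
        · intro i hi
          cases i with
          | zero => exact hef
          | succ i =>
            rw [anc_consSeq, anc_consSeq, hτ]
            exact hk i (by omega)
        · rw [anc_consSeq, anc_consSeq, anc_consSeq, hτ]
          exact hg _ (parent_mem_core hgc _ _) (hc g hgc ▸ hS' _ hgS)
      have h' := List.all_eq_true.1 h (xor (o 0) (o 1)) (by cases xor (o 0) (o 1) <;> simp)
      simp only [force_eq] at h'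
      generalize hδ : xor (o 0) (o 1) = δ at h' step
      obtain ⟨S₀, e₀, h₀⟩ := withImage_spec (parentCode t t δ) S
        fun S₀ => withImage (parentCode t (!t) δ) S fun S₁ =>
        bif (!Nat.beq (parentCode t t δ p) (parentCode t t δ q)) &&
          (Nat.beq (parentCode t (!t) δ p) (parentCode t (!t) δ q) || shorter S₀ S₁) then
          separates n t (parentCode t t δ p) (parentCode t t δ q) S₀
        else (!Nat.beq (parentCode t (!t) δ p) (parentCode t (!t) δ q)) &&
          separates n (!t) (parentCode t (!t) δ p) (parentCode t (!t) δ q) S₁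
      rw [e₀] at h'
      obtain ⟨S₁, e₁, h₁⟩ := withImage_spec (parentCode t (!t) δ) S
        fun S₁ =>
        bif (!Nat.beq (parentCode t t δ p) (parentCode t t δ q)) &&
          (Nat.beq (parentCode t (!t) δ p) (parentCode t (!t) δ q) || shorter S₀ S₁) then
          separates n t (parentCode t t δ p) (parentCode t t δ q) S₀
        else (!Nat.beq (parentCode t (!t) δ p) (parentCode t (!t) δ q)) &&
          separates n (!t) (parentCode t (!t) δ p) (parentCode t (!t) δ q) S₁
      rw [e₁] at h'
      have hb : ∀ a b : ℕ, (!Nat.beq a b) = true → a ≠ b := by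
        intro a b hab hh
        rw [hh, Nat.beq_refl] at hab
        simp at hab
      cases hs : (!Nat.beq (parentCode t t δ p) (parentCode t t δ q)) &&
          (Nat.beq (parentCode t (!t) δ p) (parentCode t (!t) δ q) || shorter S₀ S₁) with
      | true =>
        rw [hs] at h'
        rw [Bool.and_eq_true] at hs
        exact step _ _ h' (hb _ _ hs.1) h₀
      | false =>
        rw [hs, cond_false, Bool.and_eq_true] at h'
        exact step _ _ h'.2 (hb _ _ h'.1) h₁

/-! ### Choice of the vertices -/

/-- The sequence whose first `n` terms are those of `t`, followed by the terms of `t'`. -/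
def splice (n : ℕ) (t t' : ℕ → Bool) : ℕ → Bool := fun i => if i < n then t i else t' (i - n)

theorem shift_splice (n : ℕ) (t t' : ℕ → Bool) : shift n (splice n t t') = t' := by
  funext i
  simp [shift, splice]

theorem splice_eq {n : ℕ} {t t' : ℕ → Bool} (h : t' 0 = t n) {i : ℕ} (hi : i ≤ n) :
    splice n t t' i = t i := by
  rcases hi.lt_or_eq with hi | rfl
  · rw [splice, if_pos hi]
  · rw [splice, if_neg (lt_irrefl i), Nat.sub_self, h]

theorem anc_splice {n : ℕ} {t t' : ℕ → Bool} (h : t' 0 = t n) (o : ℕ → Bool) (k : ℕ) (g : Dart) :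
    anc o (splice n t t') (n + k) g = anc (shift n o) t' k (anc o t n g) := by
  rw [anc_add, shift_splice, anc_congr fun i hi => splice_eq h hi]

/-- Given finitely many edges, the vertices can be chosen so that one edge contains them all. -/
theorem exists_anc_eq (o t : ℕ → Bool) (n : ℕ) (S : Finset Dart)
    (hS : ∀ g ∈ S, Admissible (o n) (t n) g) :
    ∃ t' : ℕ → Bool, (∀ i ≤ n, t' i = t i) ∧ ∃ k, ∀ g ∈ S, ∀ g' ∈ S,
      anc (shift n o) (shift n t') k g = anc (shift n o) (shift n t') k g' := by
  have zero : ∀ o t : ℕ → Bool, (∀ g ∈ S, Admissible (o 0) (t 0) g) →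
      ∃ t' : ℕ → Bool, t' 0 = t 0 ∧ ∃ k, ∀ g ∈ S, ∀ g' ∈ S, anc o t' k g = anc o t' k g' := by
    intro o t hS
    have h : ∀ g ∈ S, ∃ N, anc o t N g ∈ core (o N) (t N) := fun g hg =>
      exists_anc_mem_core o t (hS g hg)
    choose! N hN using h
    -- The core is stable under `parent`, so all of `S` is in the core at a common level.
    have hm : ∀ g ∈ S, anc o t (S.sup N) g ∈ core (o (S.sup N)) (t (S.sup N)) := fun g hg =>
      anc_mem_core_of_le (Finset.le_sup hg) (hN g hg)
    generalize S.sup N = M at hm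
    obtain ⟨k, τ, hτ, hk⟩ := merges_sound (merges_core (t M)) (shift M o)
    refine ⟨splice M t τ, splice_eq hτ (Nat.zero_le M), M + k, fun g hg g' hg' => ?_⟩
    rw [anc_splice hτ, anc_splice hτ]
    exact hk _ (hm g hg) _ (hm g' hg') (code_mem _ _ _ (hm g hg)) (code_mem _ _ _ (hm g' hg'))
  obtain ⟨τ, hτ, h⟩ := zero (shift n o) (shift n t) hS
  refine ⟨splice n t τ, fun i hi => splice_eq (n := n) (t := t) hτ hi, ?_⟩
  rwa [shift_splice]

theorem Goal.symm {o t : Bool} {e f : Dart} (h : Goal o t e f) : Goal o t f e :=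
  ⟨h.2.1, h.1, isGoal_iff.2 (isGoal_iff.1 h.2.2).symm⟩

theorem Goal.exists_next {o : ℕ → Bool} {t : Bool} {e f : Dart} (h : Goal (o 0) t e f)
    (hef : e ≠ f) : ∃ (k : ℕ) (τ : ℕ → Bool), 0 < k ∧ τ 0 = t ∧
      Goal (o k) (τ k) (anc o τ k e) (anc o τ k f) ∧ (∀ i ≤ k, anc o τ i e ≠ anc o τ i f) ∧
      ∀ g ∈ core (o 0) t, anc o τ k g = anc o τ k e ∨ anc o τ k g = anc o τ k f := by
  have key : ∀ e f : Dart, Goal (o 0) t e f → e ≠ f →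
      (t, code (o 0) e, code (o 0) f) ∈ goals → ∃ (k : ℕ) (τ : ℕ → Bool), 0 < k ∧ τ 0 = t ∧
      Goal (o k) (τ k) (anc o τ k e) (anc o τ k f) ∧ (∀ i ≤ k, anc o τ i e ≠ anc o τ i f) ∧
      ∀ g ∈ core (o 0) t, anc o τ k g = anc o τ k e ∨ anc o τ k g = anc o τ k f := by
    intro e f h hef hg
    obtain ⟨k, τ, hτ, h1, h2, h3⟩ := separates_sound (List.all_eq_true.1 separates_core _ hg) o
      h.1 h.2.1 rfl rfl hef
    have h4 : ∀ g ∈ core (o 0) t, anc o τ k g = anc o τ k e ∨ anc o τ k g = anc o τ k f :=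
      fun g hg => h3 g hg (code_mem _ _ _ hg)
    refine ⟨k, τ, Nat.pos_of_ne_zero ?_, hτ, h1, h2, h4⟩
    -- A round takes at least one level: the core has more than two edges, so it is not merged at
    -- the start.
    rintro rfl
    obtain ⟨g, hg, hge, hgf⟩ := exists_third (o 0) t e h.1 f h.2.1
    exact (h4 g hg).elim hge hgf
  rcases isGoal_iff.1 h.2.2 with hg | hg
  · exact key e f h hef hg
  · obtain ⟨k, τ, h0, h1, h2, h3, h4⟩ := key f e h.symm hef.symm hg
    exact ⟨k, τ, h0, h1, h2.symm, fun i hi => (h3 i hi).symm, fun g hg => (h4 g hg).symm⟩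

/-- The vertices can be chosen so that any edge is contained in an edge of one of two given
infinite increasing sequences. -/
theorem exists_anc_eq_or_eq (o : ℕ → Bool) : ∃ (t : ℕ → Bool) (e f : Dart),
    Admissible (o 0) (t 0) e ∧ Admissible (o 0) (t 0) f ∧ (∀ n, anc o t n e ≠ anc o t n f) ∧
    ∀ m g, Admissible (o m) (t m) g → ∃ k,
      anc (shift m o) (shift m t) k g = anc o t (m + k) e ∨
      anc (shift m o) (shift m t) k g = anc o t (m + k) f := by
  obtain ⟨s, hs, e, he, f, hf, hce, hcf⟩ := exists_goal (o 0)
  have hef : e ≠ f := by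
    rintro rfl
    exact goals_ne s hs (hce.symm.trans hcf)
  -- State after finitely many rounds: the level reached and the bits chosen so far. Each round
  -- freezes the bits up to the level reached and starts again with the entire core, which takes
  -- care of the edges that have entered it meanwhile.
  let P : ℕ × (ℕ → Bool) → Prop := fun p =>
    Goal (o p.1) (p.2 p.1) (anc o p.2 p.1 e) (anc o p.2 p.1 f) ∧
      p.2 0 = s.1 ∧ ∀ i ≤ p.1, anc o p.2 i e ≠ anc o p.2 i f
  have next : ∀ p : {p // P p}, ∃ q : {p // P p}, p.1.1 < q.1.1 ∧
      (∀ i ≤ p.1.1, q.1.2 i = p.1.2 i) ∧ ∀ g ∈ core (o p.1.1) (p.1.2 p.1.1),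
        anc (shift p.1.1 o) (shift p.1.1 q.1.2) (q.1.1 - p.1.1) g = anc o q.1.2 q.1.1 e ∨
        anc (shift p.1.1 o) (shift p.1.1 q.1.2) (q.1.1 - p.1.1) g = anc o q.1.2 q.1.1 f := by
    rintro ⟨⟨n, t⟩, hg, h0, hne⟩
    obtain ⟨k, τ, hk, hτ, h1, h2, h3⟩ := Goal.exists_next (o := shift n o) hg (hne n le_rfl)
    refine ⟨⟨⟨n + k, splice n t τ⟩, ?_, (splice_eq hτ (Nat.zero_le n)).trans h0, fun i hi => ?_⟩,
      Nat.lt_add_of_pos_right hk, fun i hi => splice_eq hτ hi, ?_⟩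
    · have : splice n t τ (n + k) = τ k := congrFun (shift_splice n t τ) k
      simp only [anc_splice hτ, this]
      exact h1
    · rcases le_or_gt i n with h | h
      · have hc : ∀ g, anc o (splice n t τ) i g = anc o t i g :=
          anc_congr fun j hj => splice_eq hτ (hj.trans h)
        simp only [hc]
        exact hne i h
      · obtain ⟨j, rfl⟩ := Nat.exists_eq_add_of_lt h
        simp only [add_assoc, anc_splice hτ]
        exact h2 _ (by dsimp only at hi; omega)
    · simp only [Nat.add_sub_cancel_left, shift_splice, anc_splice hτ]
      exact h3
  choose next hlt hagree hcore using next
  let stage : ℕ → {p // P p} := Nat.rec ⟨(0, fun _ => s.1),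
    ⟨he, hf, isGoal_iff.2 (Or.inl (by simpa only [anc, hce, hcf] using hs))⟩, rfl, fun i hi => by
      obtain rfl : i = 0 := Nat.le_zero.1 hi
      exact hef⟩ fun _ p => next p
  have hstage : ∀ j, stage (j + 1) = next (stage j) := fun _ => rfl
  have hmono : StrictMono fun j => (stage j).1.1 := strictMono_nat_of_lt_succ fun j => hlt _
  have hst : ∀ j j', j ≤ j' → ∀ i ≤ (stage j).1.1, (stage j').1.2 i = (stage j).1.2 i := by
    intro j j' hj i hi
    induction j', hj using Nat.le_induction with
    | base => rfl
    | succ j' hj ih => rw [hstage, hagree _ i (hi.trans (hmono.monotone hj)), ih]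
  -- Diagonal choice: stage `i` has reached a level at least `i`, so its bit `i` is final.
  let t : ℕ → Bool := fun i => (stage i).1.2 i
  have ht : ∀ j, ∀ i ≤ (stage j).1.1, t i = (stage j).1.2 i := by
    intro j i hi
    rcases le_total i j with h | h
    · exact (hst i j h i (hmono.id_le i)).symm
    · exact hst j i h i hi
  have h0 : t 0 = s.1 := (stage 0).2.2.1
  refine ⟨t, e, f, ?_, ?_, fun n => ?_, fun m g hg => ?_⟩
  · rw [h0]; exact (mem_core.1 he).1
  · rw [h0]; exact (mem_core.1 hf).1
  · have hn : n ≤ (stage n).1.1 := hmono.id_le n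
    rw [anc_congr fun i hi => ht n i (hi.trans hn), anc_congr fun i hi => ht n i (hi.trans hn)]
    exact (stage n).2.2.2 n hn
  · obtain ⟨n, hn⟩ := exists_anc_mem_core (shift m o) (shift m t) hg
    have hle : m + n ≤ (stage (m + n)).1.1 := hmono.id_le _
    have hlt' := hlt (stage (m + n))
    have hcore' := hcore (stage (m + n))
    have ht' := ht (m + n + 1)
    have ht'' := ht (m + n) _ le_rfl
    rw [hstage] at ht'
    generalize (next (stage (m + n))).1.2 = t' at hcore' ht'
    generalize (next (stage (m + n))).1.1 = a at hcore' ht' hlt'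
    rw [← ht''] at hcore'
    generalize (stage (m + n)).1.1 = b at hle hlt' hcore'
    obtain ⟨c, rfl⟩ := Nat.exists_eq_add_of_le hle
    obtain ⟨d, rfl⟩ := Nat.exists_eq_add_of_le hlt'.le
    have h1 : anc (shift m o) (shift m t) (n + c) g ∈ core (o (m + n + c)) (t (m + n + c)) := by
      have := anc_mem_core_of_le (Nat.le_add_right n c) hn
      rwa [shift, shift, ← add_assoc] at this
    refine ⟨n + c + d, ?_⟩
    have h2 := hcore' _ h1
    rw [Nat.add_sub_cancel_left] at h2
    have h3 : ∀ g, anc (shift (m + n + c) o) (shift (m + n + c) t') d g =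
        anc (shift (m + n + c) o) (shift (m + n + c) t) d g :=
      anc_congr fun i hi => (ht' _ (by omega)).symm
    have h4 : ∀ g, anc o t' (m + n + c + d) g = anc o t (m + n + c + d) g :=
      anc_congr fun i hi => (ht' _ hi).symm
    have h5 : ∀ o : ℕ → Bool, shift (n + c) (shift m o) = shift (m + n + c) o := fun o => by
      funext i; simp only [shift, add_assoc]
    rw [h3, h4, h4] at h2
    rw [anc_add, h5, h5, ← add_assoc, ← add_assoc]
    exact h2

/-! ### Absence of vertices which belong to all the lattices -/

theorem up_injective (t : Bool) : Function.Injective (up t) := fun x y h => by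
  rw [← half_up t x, h, half_up]

theorem tgt_ne (g : Dart) : tgt g ≠ g.1 := fun h => dv_ne_zero g.2 (add_eq_left.1 h)

theorem eq_of_anc_eq {o t : ℕ → Bool} {g h : Dart} (hg : Admissible (o 0) (t 0) g)
    (hh : Admissible (o 0) (t 0) h) {n : ℕ} (ha : anc o t n g = anc o t n h)
    (hp : pos o t n g = pos o t n h) : g = h := by
  have h1 := expand_anc_pos hg n
  rw [ha, hp, expand_anc_pos hh n] at h1
  exact (Option.some_injective _ h1).symm

section Vertex

variable {o t : ℕ → Bool} {v : ℕ → GaussianInt}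

/-- An edge which leaves a vertex common to all the lattices is a first half at every level. -/
theorem anc_source (hv : ∀ n, v n = up (t n) (v (n + 1))) {g : Dart}
    (hg : Admissible (o 0) (t 0) g) (h : g.1 = v 0) (n : ℕ) :
    (anc o t n g).1 = v n ∧ pos o t n g = 0 := by
  induction n with
  | zero => exact ⟨h, rfl⟩
  | succ n ih =>
    have ha := admissible_anc hg n
    have hd : odd (anc o t n g).2 = o n := by
      rw [ha, ih.1, hv n, parity_up]
      cases t n <;> simp
    refine ⟨up_injective (t n) ?_, by rw [pos, ih.2, if_pos hd]⟩
    rw [← hv, ← ih.1]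
    exact congrArg Prod.fst (child₁_parent ha hd (o (n + 1)) (t (n + 1)))

theorem anc_target (hv : ∀ n, v n = up (t n) (v (n + 1))) {g : Dart}
    (hg : Admissible (o 0) (t 0) g) (h : tgt g = v 0) (n : ℕ) : tgt (anc o t n g) = v n := by
  induction n with
  | zero => exact h
  | succ n ih =>
    have ha := admissible_anc hg n
    have hd : odd (anc o t n g).2 ≠ o n := by
      have hp : parity (tgt (anc o t n g)) = t n := by rw [ih, hv n, parity_up]
      rw [tgt, parity_add_dv] at hp
      rw [ha, ← hp]
      cases parity (anc o t n g).1 <;> simp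
    apply up_injective (t n)
    rw [← hv, ← ih, ← tgt_child₂ (o n), anc, child₂_parent ha hd]

end Vertex

/-- Any edge is contained in one of the edges `anc o t n e`, `anc o t n f`. -/
def Absorbs (o t : ℕ → Bool) (e f : Dart) : Prop :=
  ∀ m g, Admissible (o m) (t m) g → ∃ k,
    anc (shift m o) (shift m t) k g = anc o t (m + k) e ∨
    anc (shift m o) (shift m t) k g = anc o t (m + k) f

theorem Absorbs.symm {o t : ℕ → Bool} {e f : Dart} (h : Absorbs o t e f) : Absorbs o t f e :=
  fun m g hg => (h m g hg).imp fun _ => Or.symm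

/-- Two outgoing edges and one incoming edge at such a vertex never merge: the outgoing ones both
keep position `0`, and an ancestor shared with the incoming one would be a loop. Three edges cannot
be absorbed in two classes without merging. -/
theorem Absorbs.false_of_vertex {o t : ℕ → Bool} {e f : Dart} (h : Absorbs o t e f) (m : ℕ)
    {v : ℕ → GaussianInt} (hv : ∀ n, v n = up (t (m + n)) (v (n + 1))) : False := by
  obtain ⟨d, hd⟩ : ∃ d, odd d = o m := by
    have : ∀ b, ∃ d, odd d = b := by decide
    exact this _
  have hodd : ∀ d, odd (d + 2) = odd d ∧ odd (d + 1) = !odd d ∧ d ≠ d + 2 := by decide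
  have hp : parity (v 0) = t m := by rw [hv 0, parity_up]; rfl
  have ha : Admissible (o m) (t m) (v 0, d) := by
    simp only [Admissible, hp, hd]
    cases o m <;> cases t m <;> rfl
  have hb : Admissible (o m) (t m) (v 0, d + 2) := by
    simp only [Admissible, hp, hd, (hodd d).1]
    cases o m <;> cases t m <;> rfl
  have hc : Admissible (o m) (t m) (v 0 - dv (d + 1), d + 1) := by
    simp only [Admissible, hp, hd, (hodd d).2.1, parity_sub_dv]
    cases o m <;> cases t m <;> rfl
  have later : ∀ g, Admissible (o m) (t m) g → ∃ k, ∀ k' ≥ k,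
      anc (shift m o) (shift m t) k' g = anc o t (m + k') e ∨
      anc (shift m o) (shift m t) k' g = anc o t (m + k') f := by
    intro g hg
    obtain ⟨k, hk⟩ := h m g hg
    refine ⟨k, fun k' hk' => ?_⟩
    simp only [anc_add o t m] at hk ⊢
    exact hk.imp (anc_eq_of_le hk') (anc_eq_of_le hk')
  obtain ⟨k₁, h₁⟩ := later _ ha
  obtain ⟨k₂, h₂⟩ := later _ hb
  obtain ⟨k₃, h₃⟩ := later _ hc
  have h₁ := h₁ (k₁ + k₂ + k₃) (by omega)
  have h₂ := h₂ (k₁ + k₂ + k₃) (by omega)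
  have h₃ := h₃ (k₁ + k₂ + k₃) (by omega)
  generalize k₁ + k₂ + k₃ = k at h₁ h₂ h₃
  have s₁ := anc_source (o := shift m o) (t := shift m t) hv ha rfl k
  have s₂ := anc_source (o := shift m o) (t := shift m t) hv hb rfl k
  have s₃ := anc_target (o := shift m o) (t := shift m t) hv hc (sub_add_cancel _ _) k
  have n₁₂ : anc (shift m o) (shift m t) k (v 0, d) ≠
      anc (shift m o) (shift m t) k (v 0, d + 2) := fun he =>
    (hodd d).2.2 (congrArg Prod.snd (eq_of_anc_eq (o := shift m o) (t := shift m t) ha hb he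
      (s₁.2.trans s₂.2.symm)))
  have n₁₃ : anc (shift m o) (shift m t) k (v 0, d) ≠
      anc (shift m o) (shift m t) k (v 0 - dv (d + 1), d + 1) := fun he => by
    rw [← he] at s₃
    exact tgt_ne _ (s₃.trans s₁.1.symm)
  have n₂₃ : anc (shift m o) (shift m t) k (v 0, d + 2) ≠
      anc (shift m o) (shift m t) k (v 0 - dv (d + 1), d + 1) := fun he => by
    rw [← he] at s₃
    exact tgt_ne _ (s₃.trans s₂.1.symm)
  rcases h₁ with h₁ | h₁ <;> rcases h₂ with h₂ | h₂ <;> rcases h₃ with h₃ | h₃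
  all_goals first
    | exact n₁₂ (h₁.trans h₂.symm)
    | exact n₁₃ (h₁.trans h₃.symm)
    | exact n₂₃ (h₂.trans h₃.symm)

theorem pos_mono (o t : ℕ → Bool) (g : Dart) : Monotone fun n => pos o t n g :=
  monotone_nat_of_le_succ fun n => by
    rw [pos]
    exact Nat.le_add_right _ _

theorem pos_add_le {o t : ℕ → Bool} {g : Dart} {n m L : ℕ} (hnm : n ≤ m)
    (h : pos o t n g + L < 2 ^ n) : pos o t m g + L < 2 ^ m := by
  induction m, hnm using Nat.le_induction with
  | base => exact h
  | succ m hm ih => rw [pos, pow_succ]; split <;> omega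

theorem Absorbs.le_pos {o t : ℕ → Bool} {e f : Dart} (h : Absorbs o t e f)
    (he : Admissible (o 0) (t 0) e) (L : ℕ) : ∃ n, L ≤ pos o t n e := by
  induction L with
  | zero => exact ⟨0, Nat.zero_le _⟩
  | succ L ih =>
    obtain ⟨n, hn⟩ := ih
    by_contra! hc
    -- If the position stopped growing, all later ancestors would be first halves and share their
    -- source.
    refine h.false_of_vertex n (v := fun i => (anc o t (n + i) e).1) fun i => ?_
    have hd : odd (anc o t (n + i) e).2 = o (n + i) := by
      by_contra hd
      have h1 := hc (n + i + 1)
      rw [pos, if_neg hd] at h1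
      have h2 : pos o t n e ≤ pos o t (n + i) e := pos_mono o t e (Nat.le_add_right n i)
      have := Nat.two_pow_pos (n + i)
      omega
    exact (congrArg Prod.fst (child₁_parent (admissible_anc he (n + i)) hd _ _)).symm

theorem Absorbs.pos_add_lt {o t : ℕ → Bool} {e f : Dart} (h : Absorbs o t e f)
    (he : Admissible (o 0) (t 0) e) (L : ℕ) : ∃ n, pos o t n e + L < 2 ^ n := by
  induction L with
  | zero => exact ⟨0, pos_lt _ _ _ _⟩
  | succ L ih =>
    obtain ⟨n, hn⟩ := ih
    by_contra! hc
    refine h.false_of_vertex n (v := fun i => tgt (anc o t (n + i) e)) fun i => ?_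
    have hd : odd (anc o t (n + i) e).2 ≠ o (n + i) := by
      intro hd
      have h1 := hc (n + i + 1)
      rw [pos, if_pos hd, pow_succ] at h1
      have h2 := pos_add_le (Nat.le_add_right n i) hn
      have := Nat.two_pow_pos (n + i)
      omega
    have := congrArg tgt (child₂_parent (admissible_anc he (n + i)) hd (o (n + i + 1)) (t (n + i + 1)))
    rw [tgt_child₂] at this
    exact this.symm

/-! ### Infinite paths -/

/-- `E` is the infinite path which is the union of the paths associated to `anc o t n e`. -/
structure IsLine (o t : ℕ → Bool) (e : Dart) (E : ℤ → Dart) : Prop where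
  admissible : ∀ k, Admissible (o 0) (t 0) (E k)
  exists_level : ∀ M : ℕ, ∃ N, ∀ n ≥ N, ∀ k : ℤ, |k| ≤ M →
    anc o t n (E k) = anc o t n e ∧ (pos o t n (E k) : ℤ) = pos o t n e + k

theorem Absorbs.exists_isLine {o t : ℕ → Bool} {e f : Dart} (h : Absorbs o t e f)
    (he : Admissible (o 0) (t 0) e) : ∃ E, IsLine o t e E := by
  have key : ∀ M : ℕ, ∃ n, ∀ k : ℤ, |k| ≤ M → ∃ g, Admissible (o 0) (t 0) g ∧
      anc o t n g = anc o t n e ∧ (pos o t n g : ℤ) = pos o t n e + k := by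
    intro M
    obtain ⟨n₁, h₁⟩ := h.le_pos he M
    obtain ⟨n₂, h₂⟩ := h.pos_add_lt he M
    have h₁ := h₁.trans (pos_mono o t e (le_max_left n₁ n₂))
    have h₂ := pos_add_le (le_max_right n₁ n₂) h₂
    generalize max n₁ n₂ = n at h₁ h₂
    refine ⟨n, fun k hk => ?_⟩
    rw [abs_le] at hk
    dsimp only at h₁
    have hlt : (pos o t n e + k).toNat < (expand o t n (anc o t n e)).length := by
      rw [expand_length]; omega
    obtain ⟨h3, h4, h5⟩ := anc_of_mem_expand (admissible_anc he n) (List.getElem?_eq_getElem hlt)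
    exact ⟨_, h3, h4, by rw [h5]; omega⟩
  -- The edge at relative position `k` from `e` is the same at whatever level it is read.
  have unique : ∀ {n m : ℕ} {g h : Dart} {k : ℤ}, Admissible (o 0) (t 0) g →
      Admissible (o 0) (t 0) h → anc o t n g = anc o t n e → anc o t m h = anc o t m e →
      (pos o t n g : ℤ) = pos o t n e + k → (pos o t m h : ℤ) = pos o t m e + k → g = h := by
    intro n m g h k hg hh ag ah pg ph
    have h1 := pos_sub_eq_of_le (le_max_left n m) ag
    have h2 := pos_sub_eq_of_le (le_max_right n m) ah
    refine eq_of_anc_eq hg hh (n := max n m) ?_ (by omega)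
    rw [anc_eq_of_le (le_max_left n m) ag, anc_eq_of_le (le_max_right n m) ah]
  have hE : ∀ k : ℤ, ∃ g, Admissible (o 0) (t 0) g ∧ ∃ n,
      anc o t n g = anc o t n e ∧ (pos o t n g : ℤ) = pos o t n e + k := fun k => by
    obtain ⟨n, hn⟩ := key k.natAbs
    obtain ⟨g, hg, h⟩ := hn k (by simp)
    exact ⟨g, hg, n, h⟩
  choose E hE m h1 h2 using hE
  refine ⟨E, hE, fun M => ?_⟩
  obtain ⟨N, hN⟩ := key M
  refine ⟨N, fun n hn k hk => ?_⟩
  obtain ⟨g, hg, h3, h4⟩ := hN k hk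
  rw [unique (hE k) hg (h1 k) h3 (h2 k) h4]
  have := pos_sub_eq_of_le hn h3
  exact ⟨anc_eq_of_le hn h3, by omega⟩

namespace IsLine

variable {o t : ℕ → Bool} {e : Dart} {E : ℤ → Dart}

theorem exists_eq (h : IsLine o t e E) {n : ℕ} {g : Dart} (hg : Admissible (o 0) (t 0) g)
    (ha : anc o t n g = anc o t n e) : E (pos o t n g - pos o t n e) = g := by
  obtain ⟨N, hN⟩ := h.exists_level ((pos o t n g - pos o t n e : ℤ)).natAbs
  obtain ⟨h1, h2⟩ := hN (max n N) (le_max_right _ _) (pos o t n g - pos o t n e) (by simp)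
  have h3 := pos_sub_eq_of_le (le_max_left n N) ha
  refine eq_of_anc_eq (h.admissible _) hg (n := max n N) ?_ (by omega)
  rw [h1, anc_eq_of_le (le_max_left _ _) ha]

theorem injective (h : IsLine o t e E) : Function.Injective E := by
  intro k k' hk
  obtain ⟨N, hN⟩ := h.exists_level (max k.natAbs k'.natAbs)
  have h1 := hN N le_rfl k (by simp)
  have h2 := hN N le_rfl k' (by simp)
  rw [hk] at h1
  omega

theorem ne {f : Dart} {F : ℤ → Dart} (h : IsLine o t e E) (h' : IsLine o t f F)
    (hef : ∀ n, anc o t n e ≠ anc o t n f) (k k' : ℤ) : E k ≠ F k' := by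
  intro hk
  obtain ⟨N, hN⟩ := h.exists_level k.natAbs
  obtain ⟨N', hN'⟩ := h'.exists_level k'.natAbs
  have h1 := (hN (max N N') (le_max_left _ _) k (by simp)).1
  have h2 := (hN' (max N N') (le_max_right _ _) k' (by simp)).1
  rw [hk] at h1
  exact hef _ (h1.symm.trans h2)

theorem exists_expand (h : IsLine o t e E) (M : ℕ) : ∃ N, ∀ n ≥ N, ∀ k : ℤ, |k| ≤ M →
    ∃ j : ℕ, (j : ℤ) = pos o t n e + k ∧ (expand o t n (anc o t n e))[j]? = some (E k) := by
  obtain ⟨N, hN⟩ := h.exists_level M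
  refine ⟨N, fun n hn k hk => ⟨pos o t n (E k), (hN n hn k hk).2, ?_⟩⟩
  rw [← (hN n hn k hk).1]
  exact expand_anc_pos (h.admissible k) n

theorem isChain (h : IsLine o t e E) (k : ℤ) :
    (E (k + 1)).1 = tgt (E k) ∧ Perp (E k).2 (E (k + 1)).2 := by
  obtain ⟨N, hN⟩ := h.exists_expand (k.natAbs + 1)
  obtain ⟨i, hi, hi'⟩ := hN N le_rfl k (by rw [abs_le]; omega)
  obtain ⟨j, hj, hj'⟩ := hN N le_rfl (k + 1) (by rw [abs_le]; omega)
  obtain rfl : j = i + 1 := by omega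
  rw [List.getElem?_eq_some_iff] at hi' hj'
  obtain ⟨_, h1⟩ := hi'
  obtain ⟨hl, h2⟩ := hj'
  have := List.isChain_iff_getElem.1
    (path_isChain (emb t N (anc o t N e).1) (word_isChain o N (anc o t N e).2)) i hl
  rw [← h1, ← h2]
  exact this

theorem window_infix_word (h : IsLine o t e E) (k : ℤ) (l : ℕ) :
    ∃ n, window (fun k => (E k).2) k l <:+: word o n (anc o t n e).2 := by
  obtain ⟨N, hN⟩ := h.exists_expand (k.natAbs + l)
  refine ⟨N, ?_⟩
  obtain ⟨j, hj, -⟩ := hN N le_rfl k (by rw [abs_le]; omega)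
  have : window (fun k => (E k).2) k l = ((word o N (anc o t N e).2).drop j).take l := by
    apply List.ext_getElem?
    intro i
    rcases lt_or_ge i l with hi | hi
    · obtain ⟨j', hj', he⟩ := hN N le_rfl (k + i) (by rw [abs_le]; omega)
      obtain rfl : j' = j + i := by omega
      rw [List.getElem?_take_of_lt hi, List.getElem?_drop,
        ← path_map_snd (emb t N (anc o t N e).1) (word o N (anc o t N e).2), List.getElem?_map]
      erw [he]
      simp [window, hi]
    · rw [List.getElem?_eq_none (by simpa using hi), List.getElem?_eq_none (by simp; omega)]
  rw [this]
  exact (List.take_prefix _ _).isInfix.trans (List.drop_suffix _ _).isInfix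

end IsLine

/-! ### Curves -/

theorem dv_cases (d : ZMod 4) : dv d = 1 ∨ dv d = -1 ∨ dv d = I ∨ dv d = -I := by
  revert d; decide

/-- The oriented segment associated to an edge. -/
def toSeg (g : Dart) : Segment := ⟨g.1, dv g.2, dv_cases g.2⟩

theorem toSeg_injective : Function.Injective toSeg := fun _ _ e =>
  Prod.ext (congrArg Segment.source e) (dv_injective (congrArg Segment.dir e))

theorem support_toSeg (g : Dart) : (toSeg g).support = s(g.1, tgt g) := rfl

theorem dv_add_angle (d : ZMod 4) (a : ℤˣ) :
    dv (d + angle a) = (((a : ℤˣ) : ℤ) : GaussianInt) * I * dv d := by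
  revert d a; decide

theorem add_angle_turnOf {d d' : ZMod 4} (h : Perp d d') : d' = d + angle (turnOf d d') := by
  have key : ∀ d d', (d' = d + 1 ∨ d' = d + 3) → d' = d + angle (turnOf d d') := by decide
  exact key d d' h

/-- The curve associated to an infinite path. -/
def IsLine.curve {o t : ℕ → Bool} {e : Dart} {E : ℤ → Dart} (h : IsLine o t e E) :
    CompleteCurve where
  seg k := toSeg (E k)
  turn k := turnOf (E k).2 (E (k + 1)).2
  source_succ k := (h.isChain k).1
  dir_succ k := (congrArg dv (add_angle_turnOf (h.isChain k).2)).trans (dv_add_angle _ _)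

theorem IsLine.isFolding_curve {o t : ℕ → Bool} {e : Dart} {E : ℤ → Dart} (h : IsLine o t e E) :
    h.curve.IsFolding :=
  isCompleteFoldingSequence_of_window (f := fun k => (E k).2)
    (fun k => add_angle_turnOf (h.isChain k).2)
    fun k l => let ⟨n, hn⟩ := h.window_infix_word k l; ⟨o, n, _, hn⟩

theorem eq_or_eq_of_support_eq {g h : Dart} (e : (toSeg g).support = (toSeg h).support) :
    g = h ∨ g = (tgt h, h.2 + 2) := by
  have neg : ∀ d, dv (d + 2) = -dv d := by decide
  rw [support_toSeg, support_toSeg, Sym2.eq_iff] at e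
  rcases e with ⟨h1, h2⟩ | ⟨h1, h2⟩
  · left
    rw [tgt, tgt, h1] at h2
    exact Prod.ext h1 (dv_injective (add_left_cancel h2))
  · right
    rw [tgt, h1, tgt, add_assoc, add_eq_left] at h2
    exact Prod.ext h1 (dv_injective (by rw [neg]; exact (neg_eq_of_add_eq_zero_right h2).symm))

/-- Each nonoriented interval has exactly one admissible orientation; this makes the union of the
classes cover each interval exactly once. -/
theorem admissible_reverse (o t : Bool) (g : Dart) :
    Admissible o t (tgt g, g.2 + 2) ↔ ¬Admissible o t g := by
  have hodd : ∀ d, odd (d + 2) = odd d := by decide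
  simp only [Admissible, hodd, tgt, parity_add_dv]
  cases odd g.2 <;> cases parity g.1 <;> cases o <;> cases t <;> simp

theorem Admissible.eq_of_support_eq {o t : Bool} {g h : Dart} (hg : Admissible o t g)
    (hh : Admissible o t h) (e : (toSeg g).support = (toSeg h).support) : g = h := by
  rcases eq_or_eq_of_support_eq e with rfl | rfl
  · rfl
  · exact absurd hh ((admissible_reverse o t h).1 hg)

theorem exists_admissible (o t : Bool) (g : Dart) :
    ∃ h, Admissible o t h ∧ (toSeg h).support = (toSeg g).support ∧ (h.1 = g.1 ∨ h.1 = tgt g) := by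
  by_cases hg : Admissible o t g
  · exact ⟨g, hg, rfl, Or.inl rfl⟩
  · refine ⟨_, (admissible_reverse o t g).2 hg, ?_, Or.inr rfl⟩
    have neg : ∀ d, dv (d + 2) = -dv d := by decide
    rw [support_toSeg, support_toSeg, Sym2.eq_swap]
    simp [tgt, neg]

/-- The two infinite paths form a covering. -/
theorem Absorbs.isCovering {o t : ℕ → Bool} {e f : Dart} (h : Absorbs o t e f)
    (hef : ∀ n, anc o t n e ≠ anc o t n f) {E F : ℤ → Dart} (hE : IsLine o t e E)
    (hF : IsLine o t f F) : IsCovering {hE.curve, hF.curve} := by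
  intro z ε hε
  obtain ⟨d, rfl⟩ : ∃ d, ε = dv d := by
    rcases hε with rfl | rfl
    · exact ⟨0, by decide⟩
    · exact ⟨1, by decide⟩
  obtain ⟨g, hg, hs, -⟩ := exists_admissible (o 0) (t 0) (z, d)
  have hs' : (toSeg g).support = s(z, z + dv d) := hs
  rw [← hs']
  obtain ⟨k, hk⟩ := h 0 g hg
  have h0 : ∀ o : ℕ → Bool, shift 0 o = o := fun o => funext fun i => by rw [shift, zero_add]
  rw [h0, h0, zero_add] at hk
  apply existsUnique_of_exists_of_unique
  · rcases hk with hk | hk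
    · exact ⟨(hE.curve, _), Set.mem_insert _ _,
        congrArg (Segment.support ∘ toSeg) (hE.exists_eq hg hk)⟩
    · exact ⟨(hF.curve, _), Set.mem_insert_of_mem _ rfl,
        congrArg (Segment.support ∘ toSeg) (hF.exists_eq hg hk)⟩
  · rintro ⟨C, k⟩ ⟨C', k'⟩ ⟨hC, hk⟩ ⟨hC', hk'⟩
    have hkk := hk.trans hk'.symm
    have key : ∀ {E F : ℤ → Dart} (k k' : ℤ), (∀ k, Admissible (o 0) (t 0) (E k)) →
        (∀ k, Admissible (o 0) (t 0) (F k)) →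
        (toSeg (E k)).support = (toSeg (F k')).support → E k = F k' := fun k k' hE hF h =>
      (hE k).eq_of_support_eq (hF k') h
    rcases hC with rfl | rfl <;> rcases hC' with rfl | rfl
    · rw [hE.injective (key k k' hE.admissible hE.admissible hkk)]
    · exact absurd (key k k' hE.admissible hF.admissible hkk) (hE.ne hF hef _ _)
    · exact absurd (key k k' hF.admissible hE.admissible hkk).symm (hE.ne hF hef _ _)
    · rw [hF.injective (key k k' hF.admissible hF.admissible hkk)]

theorem IsLine.curve_ne {o t : ℕ → Bool} {e f : Dart} {E F : ℤ → Dart}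
    (hef : ∀ n, anc o t n e ≠ anc o t n f) (hE : IsLine o t e E) (hF : IsLine o t f F) :
    hE.curve ≠ hF.curve := fun h =>
  hE.ne hF hef 0 0 (toSeg_injective (congrFun (congrArg CompleteCurve.seg h) 0))

/-! ### Embeddings -/

theorem exists_toSeg_eq (s : Segment) : ∃ g, toSeg g = s := by
  obtain ⟨d, hd⟩ : ∃ d, dv d = s.dir := by
    rcases s.dir_mem with h | h | h | h <;> rw [h]
    · exact ⟨0, by decide⟩
    · exact ⟨2, by decide⟩
    · exact ⟨1, by decide⟩
    · exact ⟨3, by decide⟩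
  exact ⟨(s.source, d), Segment.ext rfl hd⟩

theorem Segment.target_translate (s : Segment) (u : GaussianInt) :
    (s.translate u).target = s.target + u := add_right_comm _ _ _

theorem Segment.translate_translate (s : Segment) (u v : GaussianInt) :
    (s.translate u).translate v = s.translate (u + v) :=
  Segment.ext (add_assoc _ _ _) rfl

theorem Segment.translate_injective (u : GaussianInt) :
    Function.Injective (Segment.translate u) := fun _ _ h =>
  Segment.ext (add_right_cancel (congrArg Segment.source h)) (congrArg (fun s => s.dir) h :)

theorem Segment.support_translate (s : Segment) (u : GaussianInt) :
    (s.translate u).support = s.support.map (· + u) := by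
  rw [support, target_translate]
  rfl

theorem Segment.exists_support_eq (s : Segment) :
    ∃ z ε : GaussianInt, (ε = 1 ∨ ε = I) ∧ s.support = s(z, z + ε) := by
  have key : ∀ ε : GaussianInt, s.dir = -ε → s.support = s(s.target, s.target + ε) := by
    intro ε h
    rw [support, Sym2.eq_swap, target, h, neg_add_cancel_right]
  rcases s.dir_mem with h | h | h | h
  · exact ⟨s.source, 1, Or.inl rfl, by rw [support, target, h]⟩
  · exact ⟨_, 1, Or.inl rfl, key _ h⟩
  · exact ⟨s.source, I, Or.inr rfl, by rw [support, target, h]⟩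
  · exact ⟨_, I, Or.inr rfl, key _ h⟩

section Covering

variable {𝒞 𝒟 : Set CompleteCurve}

theorem IsCovering.eq_of_support_eq (h : IsCovering 𝒞) {C C' : CompleteCurve} (hC : C ∈ 𝒞)
    (hC' : C' ∈ 𝒞) {k k' : ℤ} (e : (C.seg k).support = (C'.seg k').support) : C = C' ∧ k = k' := by
  obtain ⟨z, ε, hε, hs⟩ := (C'.seg k').exists_support_eq
  exact Prod.ext_iff.1 ((h z ε hε).unique (y₁ := (C, k)) (y₂ := (C', k')) ⟨hC, e.trans hs⟩ ⟨hC', hs⟩)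

theorem IsCovering.nonempty (h : IsCovering 𝒞) : 𝒞.Nonempty := by
  obtain ⟨p, hp, -⟩ := h 0 1 (Or.inl rfl)
  exact ⟨p.1, hp.1⟩

theorem IsCovering.consecutive_iff (h : IsCovering 𝒞) {C : CompleteCurve} (hC : C ∈ 𝒞) {k : ℤ}
    {s : Segment} : Consecutive 𝒞 (C.seg k) s ↔ C.seg (k + 1) = s := by
  constructor
  · rintro ⟨C', hC', k', hk, rfl⟩
    obtain ⟨rfl, rfl⟩ := h.eq_of_support_eq hC' hC (congrArg Segment.support hk)
    rfl
  · exact fun hs => ⟨C, hC, k, rfl, hs⟩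

/-- In a covering each segment has a unique successor, so it is enough to transport each segment
together with the next one, even if that one is not in `F`. -/
theorem isEmbedding_of_seg_succ (h𝒞 : IsCovering 𝒞) (h𝒟 : IsCovering 𝒟) {F : Finset Segment}
    {u : GaussianInt} (hF : ∀ s ∈ F, ∃ C ∈ 𝒞, ∃ k, ∃ D ∈ 𝒟, ∃ k', C.seg k = s ∧
      D.seg k' = (C.seg k).translate u ∧ D.seg (k' + 1) = (C.seg (k + 1)).translate u) :
    IsEmbedding 𝒞 𝒟 F u := by
  refine ⟨fun s hs => ?_, fun s hs s' _ => ?_⟩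
  · obtain ⟨C, -, k, D, hD, k', rfl, h, -⟩ := hF s hs
    exact ⟨D, hD, k', h⟩
  · obtain ⟨C, hC, k, D, hD, k', rfl, h, h'⟩ := hF s hs
    rw [h𝒞.consecutive_iff hC, ← h, h𝒟.consecutive_iff hD, h', (Segment.translate_injective u).eq_iff]

theorem IsEmbedding.trans {ℰ : Set CompleteCurve} {F F' : Finset Segment} {u v : GaussianInt}
    (h : IsEmbedding 𝒞 𝒟 F u) (h' : IsEmbedding 𝒟 ℰ F' v) (hF : ∀ s ∈ F, s.translate u ∈ F') :
    IsEmbedding 𝒞 ℰ F (u + v) := by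
  refine ⟨fun s hs => ?_, fun s hs s' hs' => ?_⟩
  · rw [← Segment.translate_translate]
    exact h'.1 _ (hF s hs)
  · rw [h.2 s hs s' hs', h'.2 _ (hF s hs) _ (hF s' hs'), Segment.translate_translate,
      Segment.translate_translate]

end Covering

/-! ### Blocks of a curve -/

/-- `f` gives the directions of the segments of `C`. -/
def IsDirection (C : CompleteCurve) (f : ℤ → ZMod 4) : Prop := ∀ k, (C.seg k).dir = dv (f k)

theorem CompleteCurve.exists_isDirection (C : CompleteCurve) : ∃ f, IsDirection C f := by
  choose g hg using fun k => exists_toSeg_eq (C.seg k)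
  exact ⟨fun k => (g k).2, fun k => (congrArg Segment.dir (hg k)).symm⟩

namespace IsDirection

variable {C : CompleteCurve} {f : ℤ → ZMod 4}

theorem succ (h : IsDirection C f) (k : ℤ) : f (k + 1) = f k + angle (C.turn k) := by
  apply dv_injective
  rw [dv_add_angle, ← h, ← h, C.dir_succ]

theorem getElem?_path (h : IsDirection C f) {p : ℤ} {l i : ℕ} (hi : i < l) :
    (path (C.seg p).source (window f p l))[i]? = some ((C.seg (p + i)).source, f (p + i)) := by
  induction l generalizing p i with
  | zero => omega
  | succ l ih =>
    rw [window_succ, path]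
    cases i with
    | zero => simp
    | succ i =>
      rw [List.getElem?_cons_succ, ← h, show (C.seg p).source + (C.seg p).dir = _ from
        (C.source_succ p).symm, ih (by omega)]
      simp [add_comm, add_left_comm]

theorem toSeg_eq (h : IsDirection C f) (k : ℤ) : toSeg ((C.seg k).source, f k) = C.seg k :=
  Segment.ext rfl (h k).symm

/-- The path associated to an edge occurs in a curve in which the associated word occurs. -/
theorem exists_translate (h : IsDirection C f) {o : ℕ → Bool} {n : ℕ} {g : Dart}
    (ho : Occurs f (word o n g.2)) (t : ℕ → Bool) : ∃ (u : GaussianInt) (p : ℤ),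
      ∀ (i : ℕ) (x : Dart), (expand o t n g)[i]? = some x → C.seg (p + i) = (toSeg x).translate u := by
  obtain ⟨p, hp⟩ := ho
  refine ⟨(C.seg p).source - emb t n g.1, p, fun i x hx => ?_⟩
  have hi : i < (word o n g.2).length := by
    by_contra hi
    rw [List.getElem?_eq_none (by simpa [expand] using hi)] at hx
    simp at hx
  have h1 := h.getElem?_path (p := p) hi
  rw [hp, ← add_sub_cancel (emb t n g.1) (C.seg p).source, path_translate, List.getElem?_map] at h1
  erw [hx] at h1
  rw [← h.toSeg_eq, ← Option.some_injective _ h1]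
  rfl

end IsDirection

theorem exists_translate_path {W W' : List (ZMod 4)} (h : W' <:+: W) (x y : GaussianInt) :
    ∃ (u : GaussianInt) (j : ℕ), ∀ (i : ℕ) (g : Dart), (path y W')[i]? = some g →
      (path x W)[j + i]? = some (g.1 + u, g.2) := by
  obtain ⟨s, s', rfl⟩ := h
  refine ⟨x + (s.map dv).sum - y, s.length, fun i g hg => ?_⟩
  have hi : i < (path y W').length := (List.getElem?_eq_some_iff.1 hg).1
  rw [List.append_assoc, path_append, List.getElem?_append_right (by simp), path_length,
    Nat.add_sub_cancel_left, path_append, List.getElem?_append_left (by simpa using hi)]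
  have : path (x + (s.map dv).sum) W' = path (y + (x + (s.map dv).sum - y)) W' := by
    rw [add_sub_cancel]
  rw [this, path_translate, List.getElem?_map, hg]
  rfl

/-- A block of a curve contains all the intervals of some disc with given radius. -/
theorem IsDirection.exists_disc {C : CompleteCurve} {f : ℤ → ZMod 4} (h : IsDirection C f)
    {o : ℕ → Bool} (ho : ∀ n d, Occurs f (word o n d)) (r : ℝ) : ∃ (z : ℂ) (p : ℤ) (l : ℕ),
      ∀ s : Segment, s.InBall z r → ∃ i : ℕ, i < l ∧ (C.seg (p + i)).support = s.support := by
  obtain ⟨R, hR⟩ := exists_nat_ge r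
  -- All admissible edges with source in a square containing the disc are put in one edge, whose
  -- word occurs in `C`. The value of `t 0` is an arbitrary choice.
  let S : Finset Dart := (((Finset.Icc (-R : ℤ) R ×ˢ Finset.Icc (-R : ℤ) R).image
    fun q => (⟨q.1, q.2⟩ : GaussianInt)) ×ˢ Finset.univ).filter fun g => Admissible (o 0) false g
  obtain ⟨t, ht, n, hn⟩ := exists_anc_eq o (fun _ => false) 0 S
    (fun g hg => (Finset.mem_filter.1 hg).2)
  have h0 : ∀ o : ℕ → Bool, shift 0 o = o := fun o => funext fun i => by rw [shift, zero_add]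
  rw [h0, h0] at hn
  obtain ⟨G, hG⟩ : ∃ G, ∀ g ∈ S, anc o t n g = G := by
    rcases S.eq_empty_or_nonempty with hS | ⟨g, hg⟩
    · exact ⟨0, by simp [hS]⟩
    · exact ⟨_, fun g' hg' => hn g' hg' g hg⟩
  obtain ⟨u, p, hu⟩ := h.exists_translate (ho n G.2) t
  refine ⟨GaussianInt.toComplex u, p, 2 ^ n, fun s hs => ?_⟩
  have hb : ∀ x : GaussianInt, GaussianInt.toComplex x ∈ Metric.ball (GaussianInt.toComplex u) r →
      (-R ≤ x.re - u.re ∧ x.re - u.re ≤ R) ∧ (-R ≤ x.im - u.im ∧ x.im - u.im ≤ R) := by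
    intro x hx
    rw [mem_ball_iff_norm, ← map_sub] at hx
    have h1 := (Complex.abs_re_le_norm _).trans (hx.le.trans hR)
    have h2 := (Complex.abs_im_le_norm _).trans (hx.le.trans hR)
    rw [← GaussianInt.intCast_re, Zsqrtd.re_sub] at h1
    rw [← GaussianInt.intCast_im, Zsqrtd.im_sub] at h2
    rw [← abs_le, ← abs_le]
    exact ⟨by exact_mod_cast h1, by exact_mod_cast h2⟩
  obtain ⟨g, hg⟩ := exists_toSeg_eq (s.translate (-u))
  obtain ⟨x, hx, hxs, hx'⟩ := exists_admissible (o 0) false g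
  have hgs : g.1 = s.source + -u := congrArg Segment.source hg
  have hgt : tgt g = s.target + -u := by
    rw [← Segment.target_translate, ← hg]
    rfl
  have hxS : x ∈ S := by
    have : (-R ≤ x.1.re ∧ x.1.re ≤ R) ∧ (-R ≤ x.1.im ∧ x.1.im ≤ R) := by
      rcases hx' with h | h
      · rw [h, hgs]
        exact hb _ hs.1
      · rw [h, hgt]
        exact hb _ hs.2
    refine Finset.mem_filter.2 ⟨Finset.mem_product.2 ⟨Finset.mem_image.2 ⟨(x.1.re, x.1.im), ?_, rfl⟩,
      Finset.mem_univ _⟩, hx⟩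
    simpa using this
  have hx0 : Admissible (o 0) (t 0) x := by rw [ht 0 le_rfl]; exact hx
  have he := expand_anc_pos hx0 n
  rw [hG x hxS] at he
  refine ⟨_, pos_lt o t n x, ?_⟩
  rw [hu _ _ he, Segment.support_translate, hxs, hg, ← Segment.support_translate,
    Segment.translate_translate, neg_add_cancel]
  exact congrArg Segment.support (Segment.ext (add_zero _) rfl)

/-! ### Local isomorphism -/

section Line

variable {o t : ℕ → Bool} {e f : Dart} {E F : ℤ → Dart} {C : CompleteCurve} {a : ℤ → ZMod 4}

/-- Each block of a curve has a copy in the infinite paths with the same parities. -/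
theorem IsLine.exists_translate (h : IsLine o t e E) (he : Admissible (o 0) (t 0) e)
    (hC : IsDirection C a) (ha : ∀ k l, ∃ n, ∀ d, window a k l <:+: word o n d) (p : ℤ) (l : ℕ) :
    ∃ (u : GaussianInt) (q : ℤ), ∀ i : ℕ, i < l →
      h.curve.seg (q + i) = (C.seg (p + i)).translate u := by
  obtain ⟨n, hn⟩ := ha p l
  obtain ⟨u, j, hu⟩ := exists_translate_path (hn (anc o t n e).2) (emb t n (anc o t n e).1)
    (C.seg p).source
  refine ⟨u, j - pos o t n e, fun i hi => ?_⟩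
  obtain ⟨h1, h2, h3⟩ := anc_of_mem_expand (admissible_anc he n) (hu i _ (hC.getElem?_path hi))
  have h4 := h.exists_eq h1 h2
  rw [h3, Nat.cast_add, add_sub_right_comm] at h4
  rw [← hC.toSeg_eq (p + i)]
  exact congrArg toSeg h4

theorem locallyEmbeds_of_isLine {𝒞 𝒟 : Set CompleteCurve} (h𝒞 : IsCovering 𝒞)
    (hloc : LocalIsomorphismProperty 𝒞) (h𝒟 : IsCovering 𝒟) (hC𝒞 : C ∈ 𝒞) (hC : IsDirection C a)
    (hw : ∀ n d, Occurs a (word o n d)) (ha : ∀ k l, ∃ n, ∀ d, window a k l <:+: word o n d)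
    (h : IsLine o t e E) (he : Admissible (o 0) (t 0) e) (h𝒟E : h.curve ∈ 𝒟) :
    LocallyEmbeds 𝒞 𝒟 := by
  classical
  intro S hS
  obtain ⟨r, hr⟩ := hloc S hS
  obtain ⟨z, p, l, hz⟩ := hC.exists_disc hw r
  obtain ⟨u, hu, hur⟩ := hr z
  -- One more segment than the block filling the disc, so that the last one keeps its successor.
  obtain ⟨v, q, hv⟩ := h.exists_translate he hC ha p (l + 1)
  refine ⟨u + v, hu.trans (F' := S.image (Segment.translate u)) ?_ fun s hs =>
    Finset.mem_image_of_mem _ hs⟩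
  refine isEmbedding_of_seg_succ h𝒞 h𝒟 fun s' hs' => ?_
  obtain ⟨s, hs, rfl⟩ := Finset.mem_image.1 hs'
  obtain ⟨i, hi, his⟩ := hz _ (hur s hs)
  obtain ⟨C', hC', k, hk⟩ := hu.1 s hs
  rw [← hk] at his
  obtain ⟨rfl, rfl⟩ := h𝒞.eq_of_support_eq hC𝒞 hC' his
  refine ⟨C, hC𝒞, p + i, h.curve, h𝒟E, q + i, hk, hv i (by omega), ?_⟩
  have := hv (i + 1) (by omega)
  rwa [Nat.cast_add, Nat.cast_one, ← add_assoc, ← add_assoc] at this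

theorem locallyEmbeds_of_occurs {𝒞 : Set CompleteCurve} (h𝒞 : IsCovering 𝒞) (hC𝒞 : C ∈ 𝒞)
    (hC : IsDirection C a) (hw : ∀ n d, Occurs a (word o n d)) (hE : IsLine o t e E)
    (hF : IsLine o t f F) (he : Admissible (o 0) (t 0) e) (hf : Admissible (o 0) (t 0) f)
    (h𝒟 : IsCovering {hE.curve, hF.curve}) : LocallyEmbeds {hE.curve, hF.curve} 𝒞 := by
  intro S hS
  obtain ⟨M, hM⟩ : ∃ M : ℕ, ∀ s ∈ S, ∃ k : ℤ, |k| < M ∧ (toSeg (E k) = s ∨ toSeg (F k) = s) := by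
    have : ∀ s ∈ S, ∃ k : ℤ, toSeg (E k) = s ∨ toSeg (F k) = s := by
      intro s hs
      obtain ⟨D, rfl | rfl, k, hk⟩ := hS s hs
      · exact ⟨k, Or.inl hk⟩
      · exact ⟨k, Or.inr hk⟩
    choose! k hk using this
    refine ⟨S.sup (fun s => (k s).natAbs) + 1, fun s hs => ⟨k s, ?_, hk s hs⟩⟩
    have := Finset.le_sup (f := fun s => (k s).natAbs) hs
    rw [abs_lt]
    omega
  obtain ⟨N₁, h₁⟩ := hE.exists_level M
  obtain ⟨N₂, h₂⟩ := hF.exists_level M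
  have h₁ := h₁ _ (le_max_left N₁ N₂)
  have h₂ := h₂ _ (le_max_right N₁ N₂)
  generalize max N₁ N₂ = n at h₁ h₂
  -- The bits up to `n` fix the pattern; the later ones are changed so that the two curves, distinct
  -- for `t`, have a common ancestor for `t'`.
  obtain ⟨t', ht', m, hm⟩ := exists_anc_eq o t n {anc o t n e, anc o t n f} (by
    simp only [Finset.mem_insert, Finset.mem_singleton, forall_eq_or_imp, forall_eq]
    exact ⟨admissible_anc he n, admissible_anc hf n⟩)
  have hG : ∃ G, anc o t' (n + m) e = G ∧ anc o t' (n + m) f = G := by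
    refine ⟨_, rfl, ?_⟩
    rw [anc_add, anc_add, anc_congr ht', anc_congr ht']
    exact hm _ (by simp) _ (by simp)
  obtain ⟨G, hGe, hGf⟩ := hG
  obtain ⟨u, p, hu⟩ := hC.exists_translate (hw (n + m) G.2) t'
  have key : ∀ (e : Dart) (E : ℤ → Dart), IsLine o t e E → anc o t' (n + m) e = G →
      (∀ k : ℤ, |k| ≤ M → anc o t n (E k) = anc o t n e ∧ (pos o t n (E k) : ℤ) = pos o t n e + k) →
      ∀ k : ℤ, |k| ≤ M → C.seg (p + pos o t' (n + m) e + k) = (toSeg (E k)).translate u := by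
    intro e E hE he h k hk
    obtain ⟨h1, h2⟩ := h k hk
    rw [← anc_congr ht', ← anc_congr ht'] at h1
    rw [← pos_congr ht', ← pos_congr ht'] at h2
    have h3 := pos_sub_eq_of_le (Nat.le_add_right n m) h1
    have h4 := expand_anc_pos (t := t') (by rw [ht' 0 n.zero_le]; exact hE.admissible k) (n + m)
    rw [anc_eq_of_le (Nat.le_add_right n m) h1, he] at h4
    rw [← hu _ _ h4]
    congr 1
    omega
  refine ⟨u, isEmbedding_of_seg_succ h𝒟 h𝒞 fun s hs => ?_⟩
  obtain ⟨k, hk, hs | hs⟩ := hM s hs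
  all_goals have hk' : |k + 1| ≤ M := by rw [abs_lt] at hk; rw [abs_le]; omega
  · refine ⟨hE.curve, Set.mem_insert _ _, k, C, hC𝒞, p + pos o t' (n + m) e + k, hs,
      key e E hE hGe h₁ k hk.le, ?_⟩
    rw [add_assoc]
    exact key e E hE hGe h₁ (k + 1) hk'
  · refine ⟨hF.curve, Set.mem_insert_of_mem _ rfl, k, C, hC𝒞, p + pos o t' (n + m) f + k, hs,
      key f F hF hGf h₂ k hk.le, ?_⟩
    rw [add_assoc]
    exact key f F hF hGf h₂ (k + 1) hk'

end Line

end Paperfolding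

theorem proposition7 (𝒞 : Set Paperfolding.CompleteCurve)
    (hcov : Paperfolding.IsCovering 𝒞)
    (hfold : ∀ C ∈ 𝒞, C.IsFolding)
    (hloc : Paperfolding.LocalIsomorphismProperty 𝒞) :
    ∃ 𝒟 : Set Paperfolding.CompleteCurve,
      Paperfolding.IsCovering 𝒟 ∧ (∀ D ∈ 𝒟, D.IsFolding) ∧ 𝒟.ncard = 2 ∧
        Paperfolding.LocallyIsomorphic 𝒞 𝒟 := by
  -- A single curve of `𝒞` provides the bits `o` used to build `𝒟`.
  obtain ⟨C, hC⟩ := hcov.nonempty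
  obtain ⟨a, ha⟩ := C.exists_isDirection
  obtain ⟨o, hw, hwin⟩ := (hfold C hC).exists_parities ha.succ
  obtain ⟨t, e, f, he, hf, hef, habs⟩ := Paperfolding.exists_anc_eq_or_eq o
  replace habs : Paperfolding.Absorbs o t e f := habs
  obtain ⟨E, hE⟩ := habs.exists_isLine he
  obtain ⟨F, hF⟩ := habs.symm.exists_isLine hf
  have h𝒟 := habs.isCovering hef hE hF
  refine ⟨{hE.curve, hF.curve}, h𝒟, ?_, Set.ncard_pair (hE.curve_ne hef hF),
    Paperfolding.locallyEmbeds_of_isLine hcov hloc h𝒟 hC ha hw hwin hE he (Set.mem_insert _ _),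
    Paperfolding.locallyEmbeds_of_occurs hcov hC ha hw hE hF he hf h𝒟⟩
  rintro D (rfl | rfl)
  · exact hE.isFolding_curve
  · exact hF.isFolding_curve
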